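/- All graphs are finite and simple. A connected graph $\Gamma$ is modular if every three vertices $x_1,x_2,x_3$ have a median, i.e. a vertex lying on a shortest path between $x_i$ and $x_j$ for all $i<j$. For an orientation $o$ of $\Gamma$, write $p\swarrow_o q$ if $pq$ is an edge that is oriented from $q$ to $p$; $o$ is admissible if for every 4-cycle $(u,v,v',u')$ one has $u\swarrow_o v\iff u'\swarrow_o v'$. Two edges $e,e'$ of $\Gamma$ are projective if there is a sequence of edges $e=e_0,e_1,\dots,e_m=e'$ such that $e_i$ and $e_{i+1}$ belong to a common 4-cycle and share no vertex; a function on the edges is orbit-invariant if it takes the same value on any two projective edges. A modular complex is a triple $\mathbf\Gamma=(\Gamma,o,h)$ of a modular graph $\Gamma$, an admissible orientation $o$ of $\Gamma$, and a positive real-valued orbit-invariant function $h$ on the edges of $\Gamma$. A pair $(p,q)$ of vertices of $\Gamma$ is Boolean, and is then denoted by $q/p$, if $p$ and $q$ are the minimum and the maximum element of the Boolean lattice whose Hasse diagram (with $u\swarrow_o v$ meaning that $v$ covers $u$) is some cube subgraph of $\Gamma$ oriented by $o$; the pairs $(p,p)$ are Boolean. The 2-subdivision $\mathbf\Gamma^*=(\Gamma^*,o^*,h^*)$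 of $\mathbf\Gamma$ is defined as follows. The vertices of $\Gamma^*$ are the Boolean pairs, and $q/p$ and $q'/p'$ are adjacent if and only if $p=p'$ and $qq'$ is an edge of $\Gamma$, or $q=q'$ and $pp'$ is an edge of $\Gamma$. One has $q/p\swarrow_{o^*}q'/p'$ if and only if $p=p'$ and $q\swarrow_o q'$, or $q=q'$ and $p'\swarrow_o p$. The edge joining $q/p$ and $q'/p$ has weight $h^*=h(qq')/2$, and the edge joining $q/p$ and $q/p'$ has weight $h^*=h(pp')/2$. Theorem. If $\mathbf\Gamma$ is a modular complex, then its 2-subdivision $\mathbf\Gamma^*$ is also a modular complex: $\Gamma^*$ is a (connected, finite) modular graph, $o^*$ is an admissible orientation of $\Gamma^*$, and $h^*$ is a positive orbit-invariant function on the edges of $\Gamma^*$. -/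

import Mathlib

/-- A simple graph on `V` together with a relation `arc` on its vertices (`arc p q`, written
`p ↙ q`, means that the edge `pq` is oriented from `q` to `p`) and a real weight on its edges. -/
structure OrientedWeightedGraph (V : Type*) where
  graph : SimpleGraph V
  arc : V → V → Prop
  weight : graph.edgeSet → ℝ

namespace SimpleGraph

variable {V : Type*}

/-- `m` is a median of `x`, `y`, `z` for the shortest path metric (of a connected graph). -/
def IsMedian (G : SimpleGraph V) (x y z m : V) : Prop :=
  G.dist x m + G.dist m y = G.dist x y ∧
  G.dist y m + G.dist m z = G.dist y z ∧
  G.dist z m + G.dist m x = G.dist z x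

/-- A modular graph: a connected graph in which every three vertices have a median. -/
def IsModular (G : SimpleGraph V) : Prop :=
  G.Connected ∧ ∀ x y z : V, ∃ m : V, G.IsMedian x y z m

/-- `(a, b, c, d)` is a 4-cycle (not necessarily an induced one). -/
def IsFourCycle (G : SimpleGraph V) (a b c d : V) : Prop :=
  G.Adj a b ∧ G.Adj b c ∧ G.Adj c d ∧ G.Adj d a ∧ a ≠ c ∧ b ≠ d

/-- `arc` chooses exactly one of the two directions of each edge. -/
def IsOrientation (G : SimpleGraph V) (arc : V → V → Prop) : Prop :=
  (∀ p q, arc p q → G.Adj p q) ∧ ∀ p q, G.Adj p q → Xor (arc p q) (arc q p)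

/-- An admissible orientation: opposite edges `ab` and `dc` of any 4-cycle `(a, b, c, d)` are
oriented in the same direction. -/
def IsAdmissible (G : SimpleGraph V) (arc : V → V → Prop) : Prop :=
  G.IsOrientation arc ∧
    ∀ a b c d, G.IsFourCycle a b c d → (arc a b ↔ arc d c)

/-- `e` and `e'` are edges without common vertex of some 4-cycle. -/
def AreOpposite (G : SimpleGraph V) (e e' : G.edgeSet) : Prop :=
  ∃ a b c d, G.IsFourCycle a b c d ∧ (e : Sym2 V) = s(a, b) ∧ (e' : Sym2 V) = s(c, d)

/-- Projectivity of edges; its classes are the orbits. -/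
def AreProjective (G : SimpleGraph V) : G.edgeSet → G.edgeSet → Prop :=
  Relation.ReflTransGen G.AreOpposite

/-- A function on the edges that is constant on every orbit. -/
def IsOrbitInvariant (G : SimpleGraph V) (h : G.edgeSet → ℝ) : Prop :=
  ∀ e e', G.AreProjective e e' → h e = h e'

end SimpleGraph

namespace OrientedWeightedGraph

variable {V : Type*}

/-- A modular complex: a finite modular graph with an admissible orientation and a positive
orbit-invariant function on the edges. -/
structure IsModularComplex (Γ : OrientedWeightedGraph V) : Prop where
  finite : Finite V
  modular : Γ.graph.IsModular
  admissible : Γ.graph.IsAdmissible Γ.arc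
  orbitInvariant : Γ.graph.IsOrbitInvariant Γ.weight
  positive : ∀ e, 0 < Γ.weight e

/-- `(p, q)` is a Boolean pair: `p` and `q` are the minimum and the maximum of a cube subgraph
(the injective image of the `n`-cube `Finset (Fin n)`) whose oriented version is the Hasse diagram
of the Boolean lattice of rank `n`. For `n = 0` these are the pairs `(p, p)`. -/
def IsBooleanPair (Γ : OrientedWeightedGraph V) (p q : V) : Prop :=
  ∃ (n : ℕ) (f : Finset (Fin n) → V), Function.Injective f ∧
    (∀ S T : Finset (Fin n), S ⋖ T → Γ.graph.Adj (f S) (f T) ∧ Γ.arc (f S) (f T)) ∧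
    f ∅ = p ∧ f Finset.univ = q

/-- The Boolean pairs; `x` with `x.lo = p` and `x.hi = q` is the pair denoted `q/p`. -/
@[ext]
structure BooleanPair (Γ : OrientedWeightedGraph V) where
  lo : V
  hi : V
  isBooleanPair : Γ.IsBooleanPair lo hi

/-- The graph of the 2-subdivision. -/
def subdivisionGraph (Γ : OrientedWeightedGraph V) : SimpleGraph Γ.BooleanPair where
  Adj x y := (x.lo = y.lo ∧ Γ.graph.Adj x.hi y.hi) ∨ (x.hi = y.hi ∧ Γ.graph.Adj x.lo y.lo)
  symm := ⟨fun _ _ h => h.imp (fun h => ⟨h.1.symm, h.2.symm⟩) (fun h => ⟨h.1.symm, h.2.symm⟩)⟩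
  loopless := ⟨fun _ h => h.elim (fun h => h.2.ne rfl) (fun h => h.2.ne rfl)⟩

/-- The orientation of the 2-subdivision. -/
def subdivisionArc (Γ : OrientedWeightedGraph V) (x y : Γ.BooleanPair) : Prop :=
  (x.lo = y.lo ∧ Γ.arc x.hi y.hi) ∨ (x.hi = y.hi ∧ Γ.arc y.lo x.lo)

theorem lo_mem_edgeSet_of_hi_notMem (Γ : OrientedWeightedGraph V)
    (e : Γ.subdivisionGraph.edgeSet)
    (he : (e : Sym2 Γ.BooleanPair).map BooleanPair.hi ∉ Γ.graph.edgeSet) :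
    (e : Sym2 Γ.BooleanPair).map BooleanPair.lo ∈ Γ.graph.edgeSet := by
  obtain ⟨e, h⟩ := e
  induction e using Sym2.ind with
  | _ x y => exact (h.resolve_left fun h' => he h'.2).2

open Classical in
/-- The edge weights of the 2-subdivision: the edge between `q/p` and `q'/p` has weight
`h(qq')/2`, and the edge between `q/p` and `q/p'` has weight `h(pp')/2`. -/
noncomputable def subdivisionWeight (Γ : OrientedWeightedGraph V)
    (e : Γ.subdivisionGraph.edgeSet) : ℝ :=
  if he : (e : Sym2 Γ.BooleanPair).map BooleanPair.hi ∈ Γ.graph.edgeSet then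
    Γ.weight ⟨_, he⟩ / 2
  else
    Γ.weight ⟨_, Γ.lo_mem_edgeSet_of_hi_notMem e he⟩ / 2

/-- The 2-subdivision. -/
noncomputable def twoSubdivision (Γ : OrientedWeightedGraph V) :
    OrientedWeightedGraph Γ.BooleanPair where
  graph := Γ.subdivisionGraph
  arc := Γ.subdivisionArc
  weight := Γ.subdivisionWeight

end OrientedWeightedGraph

/-! An admissible orientation of a modular graph generates a partial order in which directed paths
are geodesics and, between comparable vertices, all geodesics are directed. Hence the order
intervals are convex, gated and modular lattices. A pair `(p, q)` is Boolean exactly when `p ≤ q`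
and the interval `[p, q]` is complemented (`isBooleanPair_iff`), so cubes can be replaced by lattice
theory.

The distance in the 2-subdivision is the sum of the distances of the lower ends and of the upper
ends (`subdivisionGraph_dist`). The point is that, of two distinct complemented intervals, one has
an end that can be moved by an edge towards the corresponding end of the other, staying complemented
(`canApproach_or_canApproach`).

A connected graph is modular once adjacent vertices are never equidistant from a vertex and the
quadrangle condition holds (`QuadrangleCondition.isModular`). Given the distance formula, the first
property passes directly to the 2-subdivision. The second needs only that the fourth pair of a
square is again complemented: `exists_quadrangle_hi` and `exists_quadrangle_lo` when the same end
moves twice, `complemented_of_moves` when both ends move. Orientation and weights are handled by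
listing the 4-cycles (`fourCycle_cases`). -/

namespace SimpleGraph

/-! ### Modular graphs and the quadrangle condition. -/

variable {V : Type*} {G : SimpleGraph V}

theorem Connected.exists_adj_dist_add_one (hG : G.Connected) {x y : V} (h : x ≠ y) :
    ∃ z, G.Adj x z ∧ G.dist z y + 1 = G.dist x y := by
  obtain ⟨w, hw⟩ := (hG.preconnected x y).exists_walk_length_eq_dist
  cases w with
  | nil => exact absurd rfl h
  | @cons _ z _ hxz w' =>
    refine ⟨z, hxz, ?_⟩
    have h1 := dist_le w'
    have h2 := hG.dist_triangle (u := x) (v := z) (w := y)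
    rw [dist_eq_one_iff_adj.mpr hxz] at h2
    simp only [Walk.length_cons] at hw
    omega

theorem Connected.eq_of_dist_eq_zero (hG : G.Connected) {x y : V} (h : G.dist x y = 0) : x = y :=
  hG.dist_eq_zero_iff.mp h

/-- The quadrangle condition. -/
def QuadrangleCondition (G : SimpleGraph V) : Prop :=
  ∀ x a b c, G.Adj a b → G.Adj a c → b ≠ c →
    G.dist x b + 1 = G.dist x a → G.dist x c + 1 = G.dist x a →
    ∃ w, G.Adj w b ∧ G.Adj w c ∧ G.dist x w + 2 = G.dist x a

/-- The two ends of an edge have different distances to any given vertex. -/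
def EdgesSeparate (G : SimpleGraph V) : Prop :=
  ∀ x a b, G.Adj a b → G.dist x a ≠ G.dist x b

theorem EdgesSeparate.dist_cases (hG : G.Connected) (hB : G.EdgesSeparate) {a b : V}
    (h : G.Adj a b) (x : V) :
    G.dist x a = G.dist x b + 1 ∨ G.dist x b = G.dist x a + 1 := by
  have h1 := hG.dist_triangle (u := x) (v := a) (w := b)
  have h2 := hG.dist_triangle (u := x) (v := b) (w := a)
  rw [dist_eq_one_iff_adj.mpr h] at h1
  rw [dist_eq_one_iff_adj.mpr h.symm] at h2
  have := hB x a b h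
  omega

/-- A vertex of the interval between `y` and `z` that is nearest to `x` lies between `x`
and every vertex of the interval. -/
theorem QuadrangleCondition.dist_add_of_nearest (hG : G.Connected) (hB : G.EdgesSeparate)
    (hQ : G.QuadrangleCondition) {x m y : V}
    (hm : ∀ u, G.Adj m u → G.dist m y = 1 + G.dist u y → G.dist x m ≤ G.dist x u) :
    ∀ (n : ℕ) (u : V), G.dist m u = n → G.dist m u + G.dist u y = G.dist m y →
      G.dist x u = G.dist x m + G.dist m u := by
  intro n
  induction n using Nat.strong_induction_on with
  | _ n ih =>
    intro u hn hu
    rcases eq_or_ne u m with rfl | hne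
    · simp
    obtain ⟨v, huv, hv⟩ := hG.exists_adj_dist_add_one hne
    have c1 := G.dist_comm (u := m) (v := u)
    have c2 := G.dist_comm (u := m) (v := v)
    have t1 := hG.dist_triangle (u := v) (v := u) (w := y)
    have t2 := hG.dist_triangle (u := m) (v := v) (w := y)
    rw [dist_eq_one_iff_adj.mpr huv.symm] at t1
    have hv' : G.dist m v + G.dist v y = G.dist m y := by omega
    have e1 := ih (G.dist m v) (by omega) v rfl hv'
    rcases hB.dist_cases hG huv x with h | h
    · omega
    exfalso
    rcases eq_or_ne v m with rfl | hne'
    · have := hm u huv.symm (by rw [dist_eq_one_iff_adj.mpr huv.symm] at hu; omega)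
      omega
    obtain ⟨v', hvv', hv''⟩ := hG.exists_adj_dist_add_one hne'
    have c3 := G.dist_comm (u := m) (v := v')
    have t3 := hG.dist_triangle (u := v') (v := v) (w := y)
    have t4 := hG.dist_triangle (u := m) (v := v') (w := y)
    rw [dist_eq_one_iff_adj.mpr hvv'.symm] at t3
    have e2 := ih (G.dist m v') (by omega) v' rfl (by omega)
    -- If `u` were nearer to `x` than `v`, this `w` would be an interval vertex at the same distance
    -- from `m` as `v`, but nearer to `x` by two than induction allows.
    obtain ⟨w, hwv', hwu, hw⟩ := hQ x v v' u hvv' huv.symm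
      (by rintro rfl; omega) (by omega) (by omega)
    have t5 := hG.dist_triangle (u := m) (v := v') (w := w)
    have t6 := hG.dist_triangle (u := m) (v := w) (w := u)
    have t7 := hG.dist_triangle (u := w) (v := u) (w := y)
    have t8 := hG.dist_triangle (u := m) (v := w) (w := y)
    rw [dist_eq_one_iff_adj.mpr hwv'.symm] at t5
    rw [dist_eq_one_iff_adj.mpr hwu] at t6 t7
    have e3 := ih (G.dist m w) (by omega) w rfl (by omega)
    omega

/-- The median is a vertex of the interval between `y` and `z` that is nearest to `x`. -/
theorem QuadrangleCondition.isModular (hG : G.Connected) (hB : G.EdgesSeparate)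
    (hQ : G.QuadrangleCondition) : G.IsModular := by
  refine ⟨hG, fun x y z => ?_⟩
  obtain ⟨m, hm, hmin⟩ := exists_minimalFor_of_wellFoundedLT
    (fun m => G.dist y m + G.dist m z = G.dist y z) (fun m => G.dist x m) ⟨y, by simp⟩
  have hmin' : ∀ u, G.dist y u + G.dist u z = G.dist y z → G.dist x m ≤ G.dist x u := by
    intro u hu
    by_contra! hlt
    have : G.dist x m ≤ G.dist x u := hmin hu hlt.le
    omega
  have hm' : G.dist y m + G.dist m z = G.dist y z := hm
  have c1 := G.dist_comm (u := m) (v := y)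
  have key1 : G.dist x y = G.dist x m + G.dist m y := by
    refine hQ.dist_add_of_nearest hG hB (fun u hu hd => hmin' u ?_) (G.dist m y) y rfl
      (by rw [dist_self, add_zero])
    have t1 := hG.dist_triangle (u := u) (v := m) (w := z)
    have t2 := hG.dist_triangle (u := y) (v := u) (w := z)
    rw [dist_eq_one_iff_adj.mpr hu.symm] at t1
    have c2 := G.dist_comm (u := u) (v := y)
    omega
  have key2 : G.dist x z = G.dist x m + G.dist m z := by
    refine hQ.dist_add_of_nearest hG hB (fun u hu hd => hmin' u ?_) (G.dist m z) z rfl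
      (by rw [dist_self, add_zero])
    have t1 := hG.dist_triangle (u := y) (v := m) (w := u)
    have t2 := hG.dist_triangle (u := y) (v := u) (w := z)
    rw [dist_eq_one_iff_adj.mpr hu] at t1
    omega
  refine ⟨m, key1.symm, hm, ?_⟩
  rw [G.dist_comm (u := z) (v := m), G.dist_comm (u := m) (v := x), G.dist_comm (u := z) (v := x)]
  omega

theorem IsModular.edgesSeparate (hG : G.IsModular) : G.EdgesSeparate := by
  intro x a b hab h
  obtain ⟨m, h1, h2, h3⟩ := hG.2 x a b
  have c1 := G.dist_comm (u := x) (v := m)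
  have c2 := G.dist_comm (u := a) (v := m)
  have c3 := G.dist_comm (u := b) (v := m)
  have c4 := G.dist_comm (u := b) (v := x)
  rw [dist_eq_one_iff_adj.mpr hab] at h2
  omega

theorem IsModular.dist_cases (hG : G.IsModular) {a b : V} (h : G.Adj a b) (x : V) :
    G.dist x a = G.dist x b + 1 ∨ G.dist x b = G.dist x a + 1 :=
  hG.edgesSeparate.dist_cases hG.1 h x

/-- The vertices `b` and `c` are at distance 2, since adjacent ones cannot be equidistant from `x`;
a median of `x`, `b`, `c` is then the required vertex. -/
theorem IsModular.quadrangleCondition (hG : G.IsModular) : G.QuadrangleCondition := by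
  intro x a b c hab hac hbc hb hc
  obtain ⟨m, h1, h2, h3⟩ := hG.2 x b c
  have c1 := G.dist_comm (u := x) (v := m)
  have c2 := G.dist_comm (u := b) (v := m)
  have c3 := G.dist_comm (u := c) (v := m)
  have c4 := G.dist_comm (u := c) (v := x)
  have t := hG.1.dist_triangle (u := b) (v := a) (w := c)
  rw [dist_eq_one_iff_adj.mpr hab.symm, dist_eq_one_iff_adj.mpr hac] at t
  have hne : G.dist b c ≠ 0 := fun h => hbc (hG.1.eq_of_dist_eq_zero h)
  have hne1 : G.dist b c ≠ 1 := by
    intro h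
    rcases hG.dist_cases (dist_eq_one_iff_adj.mp h) x with h | h <;> omega
  exact ⟨m, dist_eq_one_iff_adj.mp (by omega), dist_eq_one_iff_adj.mp (by omega), by omega⟩

end SimpleGraph

/-! ### Order, convexity and gates in oriented modular graphs. -/

namespace SimpleGraph

variable {V : Type*} {G : SimpleGraph V} {arc : V → V → Prop}

/-- A modular graph with an admissible orientation. -/
structure IsOrientedModular (G : SimpleGraph V) (arc : V → V → Prop) : Prop where
  modular : G.IsModular
  admissible : G.IsAdmissible arc

/-- The order generated by an orientation. -/
def DirLE (arc : V → V → Prop) : V → V → Prop := Relation.ReflTransGen arc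

theorem DirLE.refl (x : V) : DirLE arc x x := Relation.ReflTransGen.refl

theorem DirLE.trans {x y z : V} (h : DirLE arc x y) (h' : DirLE arc y z) : DirLE arc x z :=
  Relation.ReflTransGen.trans h h'

theorem DirLE.of_arc {x y : V} (h : arc x y) : DirLE arc x y := Relation.ReflTransGen.single h

theorem dirLE_flip {x y : V} : DirLE (flip arc) x y ↔ DirLE arc y x :=
  Relation.reflTransGen_swap

namespace IsOrientedModular

theorem connected (h : IsOrientedModular G arc) : G.Connected := h.modular.1

theorem tri (h : IsOrientedModular G arc) (x y z : V) : G.dist x z ≤ G.dist x y + G.dist y z :=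
  h.connected.dist_triangle

theorem adj (h : IsOrientedModular G arc) {x y : V} (hxy : arc x y) : G.Adj x y :=
  h.admissible.1.1 x y hxy

theorem not_arc_symm (h : IsOrientedModular G arc) {x y : V} (hxy : arc x y) : ¬ arc y x := by
  rcases h.admissible.1.2 x y (h.adj hxy) with h | h
  · exact h.2
  · exact absurd hxy h.2

theorem arc_or_arc (h : IsOrientedModular G arc) {x y : V} (hxy : G.Adj x y) :
    arc x y ∨ arc y x := (h.admissible.1.2 x y hxy).or

theorem dist_of_arc (h : IsOrientedModular G arc) {x y : V} (hxy : arc x y) : G.dist x y = 1 :=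
  dist_eq_one_iff_adj.mpr (h.adj hxy)

theorem flip (h : IsOrientedModular G arc) : IsOrientedModular G (flip arc) := by
  refine ⟨h.modular, ⟨fun p q hpq => (h.adj hpq).symm, fun p q hpq => ?_⟩, ?_⟩
  · exact h.admissible.1.2 q p hpq.symm
  · rintro a b c d ⟨h1, h2, h3, h4, h5, h6⟩
    exact h.admissible.2 b a d c ⟨h1.symm, h4.symm, h3.symm, h2.symm, h6, h5⟩

/-- Parallel edges are oriented in the same direction. -/
theorem arc_iff_of_parallel (h : IsOrientedModular G arc) {a b c d : V} (hab : G.Adj a b)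
    (hcd : G.Adj c d) (h1 : G.dist a c = G.dist b d) (h2 : G.dist a d = G.dist b d + 1)
    (h3 : G.dist b c = G.dist b d + 1) : arc a b ↔ arc c d := by
  induction hk : G.dist b d generalizing a b with
  | zero =>
    rw [hk] at h1
    rw [h.connected.eq_of_dist_eq_zero h1, h.connected.eq_of_dist_eq_zero hk]
  | succ k ih =>
    have hne : a ≠ c := by
      rintro rfl
      rw [dist_self] at h1
      omega
    obtain ⟨a', haa', ha'⟩ := h.connected.exists_adj_dist_add_one hne
    have t1 := h.tri a' c d
    have t2 := h.tri a a' d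
    rw [dist_eq_one_iff_adj.mpr hcd] at t1
    rw [dist_eq_one_iff_adj.mpr haa'] at t2
    have c1 := G.dist_comm (u := a) (v := d)
    have c2 := G.dist_comm (u := b) (v := d)
    have c3 := G.dist_comm (u := a') (v := d)
    obtain ⟨b', hb'b, hb'a', hb'⟩ := h.modular.quadrangleCondition d a b a' hab haa'
      (by rintro rfl; omega) (by omega) (by omega)
    have c4 := G.dist_comm (u := b') (v := d)
    have t3 := h.tri b' d c
    have t4 := h.tri b b' c
    rw [dist_eq_one_iff_adj.mpr hcd.symm] at t3
    rw [dist_eq_one_iff_adj.mpr hb'b.symm] at t4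
    have := ih hb'a'.symm (by omega) (by omega) (by omega) (by omega)
    rw [← this]
    exact h.admissible.2 a b b' a' ⟨hab, hb'b.symm, hb'a', haa'.symm, by rintro rfl; omega,
      by rintro rfl; omega⟩

/-- This makes directed paths geodesic. If the arc from `q` to `r` led back towards `p`, a 4-cycle
would carry it to an arc out of the predecessor `q'` that also leads back, against induction. -/
theorem dist_of_dirLE_of_arc (h : IsOrientedModular G arc) {p q r : V} (hpq : DirLE arc p q)
    (hqr : arc q r) : G.dist p r = G.dist p q + 1 := by
  induction hpq generalizing r with
  | refl => rw [dist_self, h.dist_of_arc hqr]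
  | @tail q' q _ hq ih =>
    have h1 := ih hq
    rcases h.modular.dist_cases (h.adj hqr) p with h2 | h2
    · have hne : q' ≠ r := by
        rintro rfl
        exact h.not_arc_symm hqr hq
      obtain ⟨w, hw1, hw2, hw⟩ := h.modular.quadrangleCondition p q q' r (h.adj hq).symm
        (h.adj hqr) hne (by omega) (by omega)
      have := (h.admissible.2 q r w q' ⟨h.adj hqr, hw2.symm, hw1, h.adj hq,
        by rintro rfl; omega, hne.symm⟩).mp hqr
      have := ih this
      omega
    · exact h2

theorem dist_add_of_dirLE (h : IsOrientedModular G arc) {p x q : V} (hpx : DirLE arc p x)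
    (hxq : DirLE arc x q) : G.dist p x + G.dist x q = G.dist p q := by
  induction hxq with
  | refl => simp
  | tail h1 h2 ih =>
    rw [h.dist_of_dirLE_of_arc (hpx.trans h1) h2, h.dist_of_dirLE_of_arc h1 h2]
    omega

theorem dirLE_antisymm (h : IsOrientedModular G arc) {p q : V} (hpq : DirLE arc p q)
    (hqp : DirLE arc q p) : p = q := by
  have := h.dist_add_of_dirLE hpq hqp
  rw [dist_self] at this
  exact h.connected.eq_of_dist_eq_zero (by omega)

theorem arc_of_dirLE_of_adj (h : IsOrientedModular G arc) {p q : V} (hpq : DirLE arc p q)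
    (hadj : G.Adj p q) : arc p q := by
  rcases h.arc_or_arc hadj with h1 | h1
  · exact h1
  · exact absurd (h.dirLE_antisymm hpq (.of_arc h1)) hadj.ne

/-- Together with `dist_add_of_dirLE`, this identifies order intervals with metric intervals between
comparable vertices. -/
theorem dirLE_of_dist_add (h : IsOrientedModular G arc) {p x q : V} (hpq : DirLE arc p q)
    (hx : G.dist p x + G.dist x q = G.dist p q) : DirLE arc p x ∧ DirLE arc x q := by
  induction hn : G.dist p q generalizing q x with
  | zero =>
    obtain rfl := h.connected.eq_of_dist_eq_zero (x := p) (y := x) (by omega)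
    exact ⟨.refl _, hpq⟩
  | succ n ih =>
    -- The last edge of any geodesic: its direction is copied, across the 4-cycle `w`, `q'`, `q`,
    -- `y`, from a directed path that ends in `q'`, `q`.
    have key : ∀ y, G.Adj q y → G.dist p y = n → DirLE arc p y ∧ arc y q := by
      intro y hqy hy
      cases hpq with
      | refl => simp at hn
      | @tail q' _ hpq' hq' =>
        have e := h.dist_of_dirLE_of_arc hpq' hq'
        rcases eq_or_ne q' y with rfl | hne
        · exact ⟨hpq', hq'⟩
        obtain ⟨w, hwq', hwy, hw⟩ := h.modular.quadrangleCondition p q q' y (h.adj hq').symm hqy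
          hne (by omega) (by omega)
        have d1 := dist_eq_one_iff_adj.mpr hwq'
        have hw1 := ih (x := w) hpq' (by omega) (by omega)
        have a1 := h.arc_of_dirLE_of_adj hw1.2 hwq'
        have f1 : G.IsFourCycle w q' q y :=
          ⟨hwq', h.adj hq', hqy, hwy.symm, by rintro rfl; omega, hne⟩
        have f2 : G.IsFourCycle q' q y w :=
          ⟨h.adj hq', hqy, hwy.symm, hwq', hne, by rintro rfl; omega⟩
        exact ⟨hw1.1.trans (.of_arc ((h.admissible.2 _ _ _ _ f2).mp hq')),
          (h.admissible.2 _ _ _ _ f1).mp a1⟩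
    rcases eq_or_ne q x with rfl | hne
    · exact ⟨hpq, .refl _⟩
    obtain ⟨y, hqy, hy⟩ := h.connected.exists_adj_dist_add_one hne
    have c1 := G.dist_comm (u := q) (v := x)
    have c2 := G.dist_comm (u := y) (v := x)
    have t1 := h.tri p x y
    have t2 := h.tri p y q
    have d1 := dist_eq_one_iff_adj.mpr hqy.symm
    obtain ⟨k1, k2⟩ := key y hqy (by omega)
    obtain ⟨k3, k4⟩ := ih (x := x) k1 (by omega) (by omega)
    exact ⟨k3, k4.trans (.of_arc k2)⟩

/-- The order interval. -/
def Between (arc : V → V → Prop) (p q x : V) : Prop := DirLE arc p x ∧ DirLE arc x q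

theorem Between.le {p q x : V} (hx : Between arc p q x) : DirLE arc p q := hx.1.trans hx.2

theorem common_upper_of_common_lower (h : IsOrientedModular G arc) {x y m z : V}
    (hmx : arc m x) (hmy : arc m y) (hzx : G.Adj z x) (hzy : G.Adj z y) (hxy : x ≠ y)
    (hne : m ≠ z) : arc x z ∧ arc y z := by
  have f1 : G.IsFourCycle m x z y := ⟨h.adj hmx, hzx.symm, hzy, (h.adj hmy).symm, hne, hxy⟩
  have f2 : G.IsFourCycle m y z x := ⟨h.adj hmy, hzy.symm, hzx, (h.adj hmx).symm, hne, hxy.symm⟩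
  exact ⟨(h.admissible.2 _ _ _ _ f2).mp hmy, (h.admissible.2 _ _ _ _ f1).mp hmx⟩

theorem exists_common_lower (h : IsOrientedModular G arc) {p x y : V} (hx : DirLE arc p x)
    (hy : DirLE arc p y) (hxy : G.dist x y = 2) :
    DirLE arc x y ∨ DirLE arc y x ∨ ∃ m, DirLE arc p m ∧ arc m x ∧ arc m y := by
  obtain ⟨m, h1, h2, h3⟩ := h.modular.2 p x y
  have c1 := G.dist_comm (u := x) (v := m)
  have c2 := G.dist_comm (u := y) (v := m)
  have c3 := G.dist_comm (u := p) (v := m)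
  have c4 := G.dist_comm (u := p) (v := y)
  have m1 := h.dirLE_of_dist_add hx h1
  have m2 := h.dirLE_of_dist_add (x := m) hy (by omega)
  rcases Nat.lt_trichotomy (G.dist x m) 1 with h4 | h4 | h4
  · obtain rfl := h.connected.eq_of_dist_eq_zero (x := x) (y := m) (by omega)
    exact Or.inl m2.2
  · exact Or.inr (Or.inr ⟨m, m1.1, h.arc_of_dirLE_of_adj m1.2 (dist_eq_one_iff_adj.mp (by omega)),
      h.arc_of_dirLE_of_adj m2.2 (dist_eq_one_iff_adj.mp (by omega))⟩)
  · obtain rfl := h.connected.eq_of_dist_eq_zero (x := y) (y := m) (by omega)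
    exact Or.inr (Or.inl m1.2)

/-- The local form of convexity. If `x` and `y` are incomparable, they have a common lower cover and
a common upper cover in the interval; a third common neighbour would lie above `x` by the 4-cycle
through the former and below `x` by the one through the latter. -/
theorem between_of_common_neighbor (h : IsOrientedModular G arc) {p q x y z : V}
    (hx : Between arc p q x) (hy : Between arc p q y) (hxy : G.dist x y = 2) (hzx : G.Adj z x)
    (hzy : G.Adj z y) : Between arc p q z := by
  have hne : x ≠ y := by
    rintro rfl
    simp at hxy
  have d1 := dist_eq_one_iff_adj.mpr hzx.symm
  have d2 := dist_eq_one_iff_adj.mpr hzx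
  have d3 := dist_eq_one_iff_adj.mpr hzy
  have d4 := dist_eq_one_iff_adj.mpr hzy.symm
  have comp : ∀ {x y : V}, Between arc p q x → Between arc p q y →
      G.dist x z + G.dist z y = G.dist x y → DirLE arc x y → Between arc p q z := by
    intro x y hx hy hd hle
    obtain ⟨k1, k2⟩ := h.dirLE_of_dist_add hle hd
    exact ⟨hx.1.trans k1, k2.trans hy.2⟩
  have c := G.dist_comm (u := x) (v := y)
  rcases h.exists_common_lower hx.1 hy.1 hxy with h1 | h1 | ⟨m, h1, h2, h3⟩
  · exact comp hx hy (by omega) h1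
  · exact comp hy hx (by omega) h1
  rcases h.flip.exists_common_lower (dirLE_flip.mpr hx.2) (dirLE_flip.mpr hy.2) hxy with
    h4 | h4 | ⟨j, h4, h5, h6⟩
  · exact comp hy hx (by omega) (dirLE_flip.mp h4)
  · exact comp hx hy (by omega) (dirLE_flip.mp h4)
  rw [dirLE_flip] at h4
  rcases eq_or_ne m z with rfl | hmz
  · exact ⟨h1, (DirLE.of_arc h2).trans hx.2⟩
  rcases eq_or_ne j z with rfl | hjz
  · exact ⟨hx.1.trans (.of_arc h5), h4⟩
  exact absurd (h.common_upper_of_common_lower h2 h3 hzx hzy hne hmz).1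
    (h.not_arc_symm (h.flip.common_upper_of_common_lower h5 h6 hzx hzy hne hjz).1)

/-- Order intervals are convex. -/
theorem between_of_dist_add (h : IsOrientedModular G arc) {p q x y z : V}
    (hx : Between arc p q x) (hy : Between arc p q y)
    (hz : G.dist x z + G.dist z y = G.dist x y) : Between arc p q z := by
  induction hn : G.dist x y using Nat.strong_induction_on generalizing x z with
  | _ n ih =>
    rcases eq_or_ne x z with rfl | hne
    · exact hx
    obtain ⟨z1, hxz1, hz1⟩ := h.connected.exists_adj_dist_add_one hne
    have d1 := dist_eq_one_iff_adj.mpr hxz1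
    have t1 := h.tri z1 z y
    have t2 := h.tri x z1 y
    suffices hb : Between arc p q z1 from ih (G.dist z1 y) (by omega) hb (by omega) rfl
    by_cases hle : DirLE arc x y
    · have := h.dirLE_of_dist_add (x := z1) hle (by omega)
      exact ⟨hx.1.trans this.1, this.2.trans hy.2⟩
    -- As `x` is not below `y`, this median yields a neighbour `w` of `x` that is below `x` and on a
    -- geodesic to `y`. The quadrangle condition completes `x`, `w`, `z1` by a vertex `v`, which is
    -- in the interval by induction, so that `z1` is a common neighbour of `x` and `v`.
    obtain ⟨m, h1, h2, h3⟩ := h.modular.2 p x y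
    have c1 := G.dist_comm (u := x) (v := m)
    have c2 := G.dist_comm (u := y) (v := m)
    have c3 := G.dist_comm (u := p) (v := m)
    have c4 := G.dist_comm (u := p) (v := y)
    have hmx : x ≠ m := by
      rintro rfl
      exact hle (h.dirLE_of_dist_add (x := x) hy.1 (by omega)).2
    obtain ⟨w, hxw, hw⟩ := h.connected.exists_adj_dist_add_one hmx
    have d2 := dist_eq_one_iff_adj.mpr hxw
    have c5 := G.dist_comm (u := x) (v := w)
    have c6 := G.dist_comm (u := m) (v := w)
    have t3 := h.tri w m y
    have t4 := h.tri x w y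
    have t5 := h.tri p m w
    have t6 := h.tri p w x
    have hwb := h.dirLE_of_dist_add (x := w) hx.1 (by omega)
    have hwb' : Between arc p q w := ⟨hwb.1, hwb.2.trans hx.2⟩
    rcases eq_or_ne z1 w with rfl | hne'
    · exact hwb'
    have c7 := G.dist_comm (u := z1) (v := y)
    have c8 := G.dist_comm (u := w) (v := y)
    have c9 := G.dist_comm (u := x) (v := y)
    obtain ⟨v, hvw, hvz, hv⟩ := h.modular.quadrangleCondition y x w z1 hxw hxz1 hne'.symm
      (by omega) (by omega)
    have d3 := dist_eq_one_iff_adj.mpr hvw.symm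
    have c10 := G.dist_comm (u := v) (v := y)
    have hvb := ih (G.dist w y) (by omega) hwb' (z := v) (by omega) rfl
    have t7 := h.tri x v y
    have t8 := h.tri x w v
    exact h.between_of_common_neighbor hx hvb (by omega) hxz1.symm hvz.symm

/-- `g` is the gate of `x` in the interval between `p` and `q`. -/
def IsGate (G : SimpleGraph V) (arc : V → V → Prop) (p q x g : V) : Prop :=
  Between arc p q g ∧ ∀ y, Between arc p q y → G.dist x y = G.dist x g + G.dist g y

/-- A nearest vertex `g` works: by convexity the median of `x`, `g`, `y` lies in the interval, so it
cannot be nearer to `x` than `g`. -/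
theorem exists_gate (h : IsOrientedModular G arc) {p q : V} (hpq : DirLE arc p q) (x : V) :
    ∃ g, IsGate G arc p q x g := by
  obtain ⟨g, hg, hmin⟩ := exists_minimalFor_of_wellFoundedLT
    (Between arc p q) (fun m => G.dist x m) ⟨p, .refl _, hpq⟩
  refine ⟨g, hg, fun y hy => ?_⟩
  obtain ⟨m, h1, h2, h3⟩ := h.modular.2 x g y
  have c1 := G.dist_comm (u := x) (v := m)
  have c2 := G.dist_comm (u := y) (v := m)
  have c3 := G.dist_comm (u := g) (v := m)
  have c4 := G.dist_comm (u := x) (v := y)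
  have hm := h.between_of_dist_add hg hy h2
  have : G.dist x g ≤ G.dist x m := by
    by_contra! hlt
    have : G.dist x g ≤ G.dist x m := hmin hm hlt.le
    omega
  omega

theorem IsGate.unique (h : IsOrientedModular G arc) {p q x g g' : V} (hg : IsGate G arc p q x g)
    (hg' : IsGate G arc p q x g') : g = g' := by
  have h1 := hg.2 g' hg'.1
  have h2 := hg'.2 g hg.1
  exact h.connected.eq_of_dist_eq_zero (by omega)

theorem between_flip {p q x : V} : Between (_root_.flip arc) p q x ↔ Between arc q p x := by
  rw [Between, Between, dirLE_flip, dirLE_flip, and_comm]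

theorem isGate_flip {p q x g : V} : IsGate G (_root_.flip arc) p q x g ↔ IsGate G arc q p x g := by
  simp only [IsGate, between_flip]

/-- The gates of two adjacent vertices coincide or span an edge parallel to the given one, which
therefore has the same direction. -/
theorem IsGate.mono (h : IsOrientedModular G arc) {p q x x' g g' : V} (hxx' : DirLE arc x x')
    (hg : IsGate G arc p q x g) (hg' : IsGate G arc p q x' g') : DirLE arc g g' := by
  induction hxx' generalizing g' with
  | refl => rw [hg.unique h hg']; exact .refl _
  | @tail y x' _ hy ih =>
    obtain ⟨g1, hg1⟩ := h.exists_gate hg.1.le y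
    refine (ih hg1).trans ?_
    have e1 := hg1.2 g' hg'.1
    have e2 := hg'.2 g1 hg1.1
    have c1 := G.dist_comm (u := g1) (v := g')
    have c2 := G.dist_comm (u := y) (v := x')
    have d1 := h.dist_of_arc hy
    have t1 := h.tri y x' g'
    have t2 := h.tri x' y g1
    rcases Nat.lt_or_ge (G.dist g1 g') 1 with h1 | h1
    · rw [h.connected.eq_of_dist_eq_zero (x := g1) (y := g') (by omega)]
      exact .refl _
    · have hadj : G.Adj g1 g' := dist_eq_one_iff_adj.mp (by omega)
      exact .of_arc ((h.arc_iff_of_parallel (h.adj hy) hadj (by omega) (by omega)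
        (by omega)).mp hy)

end IsOrientedModular

end SimpleGraph

/-! ### Complemented intervals in modular lattices. -/

section ModularLattice

variable {L : Type*} [Lattice L]

/-- The interval between `a` and `b` is complemented. -/
def IsComplementedInterval (a b : L) : Prop :=
  a ≤ b ∧ ∀ x, a ≤ x → x ≤ b → ∃ y, x ⊓ y = a ∧ x ⊔ y = b

namespace IsComplementedInterval

theorem of_covBy {a b : L} (h : a ⋖ b) : IsComplementedInterval a b := by
  refine ⟨h.le, fun x h1 h2 => ?_⟩
  rcases h.eq_or_eq h1 h2 with rfl | rfl
  · exact ⟨b, inf_eq_left.mpr h2, sup_eq_right.mpr h2⟩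
  · exact ⟨a, inf_eq_right.mpr h1, sup_eq_left.mpr h1⟩

variable [IsModularLattice L]

theorem mono {a b x y : L} (h : IsComplementedInterval a b) (hax : a ≤ x) (hxy : x ≤ y)
    (hyb : y ≤ b) : IsComplementedInterval x y := by
  refine ⟨hxy, fun z hxz hzy => ?_⟩
  obtain ⟨w, hw1, hw2⟩ := h.2 z (hax.trans hxz) (hzy.trans hyb)
  refine ⟨(w ⊓ y) ⊔ x, ?_, ?_⟩
  · rw [inf_sup_assoc_of_le _ hxz |>.symm, ← inf_assoc, hw1]
    exact sup_eq_right.mpr (inf_le_left.trans hax)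
  · rw [← sup_assoc, ← sup_inf_assoc_of_le _ hzy, hw2, inf_eq_right.mpr hyb]
    exact sup_eq_left.mpr hxy

/-- A complement of `x` is built in two stages: `c'` supplies the part of `c` missing from `x ⊔ q`,
then `q'` the part of `q` missing from `x ⊔ c'`. Modularity keeps `c' ⊔ q'` disjoint from `x`. -/
theorem sup {a q c : L} (hq : IsComplementedInterval a q) (hc : IsComplementedInterval a c) :
    IsComplementedInterval a (q ⊔ c) := by
  refine ⟨hq.1.trans le_sup_left, fun x hax hx => ?_⟩
  obtain ⟨c', hc1, hc2⟩ := hc.2 ((x ⊔ q) ⊓ c) (le_inf (hax.trans le_sup_left) hc.1) inf_le_right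
  have hac' : a ≤ c' := hc1 ▸ inf_le_right
  have hc'c : c' ≤ c := hc2 ▸ le_sup_right
  obtain ⟨q', hq1, hq2⟩ := hq.2 ((x ⊔ c') ⊓ q) (le_inf (hax.trans le_sup_left) hq.1) inf_le_right
  have haq' : a ≤ q' := hq1 ▸ inf_le_right
  have hq'q : q' ≤ q := hq2 ▸ le_sup_right
  have e1 : x ⊓ c' ≤ a := by
    rw [← hc1]
    exact le_inf (le_inf (inf_le_left.trans le_sup_left) (inf_le_right.trans hc'c)) inf_le_right
  have e2 : (x ⊔ c') ⊓ q' ≤ a := by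
    rw [← hq1]
    exact le_inf (le_inf inf_le_left (inf_le_right.trans hq'q)) inf_le_right
  refine ⟨c' ⊔ q', le_antisymm ?_ (le_inf hax (hac'.trans le_sup_left)), le_antisymm ?_ ?_⟩
  · refine le_trans (le_inf inf_le_left ?_) e1
    calc x ⊓ (c' ⊔ q') ≤ (c' ⊔ q') ⊓ (x ⊔ c') :=
          le_inf inf_le_right (inf_le_left.trans le_sup_left)
      _ = c' ⊔ q' ⊓ (x ⊔ c') := sup_inf_assoc_of_le _ le_sup_right
      _ ≤ c' := sup_le le_rfl (by rw [inf_comm]; exact e2.trans hac')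
  · exact sup_le hx (sup_le (hc'c.trans le_sup_right) (hq'q.trans le_sup_left))
  · have f1 : q ≤ x ⊔ (c' ⊔ q') := by
      rw [← sup_assoc]
      calc q = (x ⊔ c') ⊓ q ⊔ q' := hq2.symm
        _ ≤ _ := sup_le_sup_right inf_le_left _
    refine sup_le f1 ?_
    calc c = (x ⊔ q) ⊓ c ⊔ c' := hc2.symm
      _ ≤ x ⊔ (c' ⊔ q') := sup_le (inf_le_left.trans (sup_le le_sup_left f1))
          (le_sup_left.trans le_sup_right)

/-- Extending a complemented interval at the top by an atom. -/
theorem of_atom {a q b c : L} (hq : IsComplementedInterval a q) (hqb : q ⋖ b) (hac : a ⋖ c)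
    (hcb : c ≤ b) (hcq : ¬ c ≤ q) : IsComplementedInterval a b := by
  have h2 : q ⊔ c = b := (hqb.eq_or_eq le_sup_left (sup_le hqb.le hcb)).resolve_left
    fun h => hcq (h ▸ le_sup_right)
  exact h2 ▸ hq.sup (of_covBy hac)

/-- By `of_atom` it suffices to find an atom over `a` that is below `b` but not below `q`. It is cut
out of any `y` in the interval with `p ≰ y` and `y ≰ q`; the complemented interval from `g'` to `g`
serves to produce such a `y`. -/
theorem of_atom_of_coatom {a b p q g g' : L} (hap : a ⋖ p) (hpq : p ≤ q) (hqb : q ⋖ b)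
    (hpb : IsComplementedInterval p b) (haq : IsComplementedInterval a q)
    (hg : IsComplementedInterval g' g) (hag : a ≤ g') (hgb : g ≤ b) (hpg : ¬ p ≤ g')
    (hgq : ¬ g ≤ q) : IsComplementedInterval a b := by
  -- Either `g` itself, or, if `p ≤ g`, a complement of `p ⊔ g'` between `g'` and `g`.
  obtain ⟨y, hay, hyb, hpy, hyq⟩ : ∃ y, a ≤ y ∧ y ≤ b ∧ ¬ p ≤ y ∧ ¬ y ≤ q := by
    by_cases hpg1 : p ≤ g
    · obtain ⟨y, hy1, hy2⟩ := hg.2 (p ⊔ g') le_sup_right (sup_le hpg1 hg.1)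
      have hg'y : g' ≤ y := hy1 ▸ inf_le_right
      refine ⟨y, hag.trans hg'y, (hy2 ▸ le_sup_right : y ≤ g).trans hgb, fun h => hpg ?_,
        fun h => hgq ?_⟩
      · rw [← hy1]
        exact le_inf le_sup_left h
      · rw [← hy2]
        exact sup_le (sup_le hpq (hg'y.trans h)) h
    · exact ⟨g, hag.trans hg.1, hgb, hpg1, hgq⟩
  have hpyb : p ⊔ y ≤ b := sup_le (hpq.trans hqb.le) hyb
  have h1 := hpb.mono le_rfl (le_sup_left : p ≤ p ⊔ y) hpyb
  -- The atom will be `x ⊓ y`: it meets `q` in `a` and joins with `q` to `b`, so it covers `a`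
  -- because `b` covers `q`.
  obtain ⟨x, hx1, hx2⟩ := h1.2 (q ⊓ (p ⊔ y)) (le_inf hpq le_sup_left) inf_le_right
  have hpx : p ≤ x := hx1 ▸ inf_le_right
  have hxy : x ≤ y ⊔ p := by
    rw [sup_comm, ← hx2]
    exact le_sup_right
  have hpya : p ⊓ y = a := (hap.eq_or_eq (le_inf hap.le hay) inf_le_left).resolve_right
    fun h => hpy (h ▸ inf_le_right)
  have hcp : x ⊓ y ⊔ p = x := by
    rw [inf_sup_assoc_of_le _ hpx, inf_eq_left]
    exact hxy
  have hcq : ¬ x ⊓ y ≤ q := by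
    intro h
    have hxq : x ≤ q := hcp ▸ sup_le h hpq
    refine hyq (le_sup_right.trans (?_ : p ⊔ y ≤ q))
    rw [← hx2]
    exact sup_le inf_le_left hxq
  have hcb : x ⊓ y ≤ b := inf_le_right.trans hyb
  have hqc : q ⊓ (x ⊓ y) = a := by
    refine le_antisymm ?_ (le_inf haq.1 (le_inf (hap.le.trans hpx) hay))
    rw [← hpya]
    refine le_inf ?_ (inf_le_right.trans inf_le_right)
    rw [← hx1]
    exact le_inf (le_inf inf_le_left (inf_le_right.trans (inf_le_left.trans
      (hxy.trans_eq (sup_comm _ _))))) (inf_le_right.trans inf_le_left)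
  have hsup : q ⊔ x ⊓ y = b := (hqb.eq_or_eq le_sup_left (sup_le hqb.le hcb)).resolve_left
    fun h => hcq (h ▸ le_sup_right)
  have hcov : a ⋖ x ⊓ y := by
    rw [← hqc]
    exact inf_covBy_of_covBy_sup_left (hsup.symm ▸ hqb)
  exact haq.of_atom hqb hcov hcb hcq

end IsComplementedInterval

end ModularLattice

/-! ### Order intervals as modular lattices. -/

namespace SimpleGraph

variable {V : Type*} {G : SimpleGraph V} {arc : V → V → Prop}

namespace IsOrientedModular

/-- The vertices of an order interval. -/
def Interval (_ : IsOrientedModular G arc) (p q : V) : Type _ := {x : V // Between arc p q x}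

variable {h : IsOrientedModular G arc} {p q : V}

instance : PartialOrder (h.Interval p q) where
  le x y := DirLE arc x.1 y.1
  le_refl _ := .refl _
  le_trans _ _ _ := DirLE.trans
  le_antisymm _ _ h1 h2 := Subtype.ext (h.dirLE_antisymm h1 h2)

/-- The meet is the gate of `y` in the interval from `p` to `x`. -/
theorem exists_inf (h : IsOrientedModular G arc) {p x y : V} (hx : DirLE arc p x)
    (hy : DirLE arc p y) : ∃ m, DirLE arc p m ∧ DirLE arc m x ∧ DirLE arc m y ∧
      (∀ z, DirLE arc p z → DirLE arc z x → DirLE arc z y → DirLE arc z m) ∧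
      G.dist x y = G.dist x m + G.dist m y := by
  obtain ⟨m, hm⟩ := h.exists_gate hx y
  have hmy : DirLE arc m y := by
    have := hm.2 p ⟨.refl _, hx⟩
    rw [G.dist_comm (u := y) (v := p), G.dist_comm (u := y), G.dist_comm (v := p)] at this
    exact (h.dirLE_of_dist_add hy (by omega)).2
  refine ⟨m, hm.1.1, hm.1.2, hmy, fun z h1 h2 h3 => ?_, ?_⟩
  · have := hm.2 z ⟨h1, h2⟩
    rw [G.dist_comm (u := y) (v := z), G.dist_comm (u := y), G.dist_comm (v := z)] at this
    exact (h.dirLE_of_dist_add h3 (by omega)).1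
  · have := hm.2 x ⟨hx, .refl _⟩
    rw [G.dist_comm (u := y) (v := x), G.dist_comm (u := y), G.dist_comm (v := x)] at this
    omega

theorem exists_sup (h : IsOrientedModular G arc) {q x y : V} (hx : DirLE arc x q)
    (hy : DirLE arc y q) : ∃ m, DirLE arc m q ∧ DirLE arc x m ∧ DirLE arc y m ∧
      (∀ z, DirLE arc z q → DirLE arc x z → DirLE arc y z → DirLE arc m z) ∧
      G.dist x y = G.dist x m + G.dist m y := by
  simpa only [dirLE_flip] using h.flip.exists_inf (dirLE_flip.mpr hx) (dirLE_flip.mpr hy)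

noncomputable instance : Lattice (h.Interval p q) where
  inf x y := ⟨(h.exists_inf x.2.1 y.2.1).choose, (h.exists_inf x.2.1 y.2.1).choose_spec.1,
    (h.exists_inf x.2.1 y.2.1).choose_spec.2.1.trans x.2.2⟩
  sup x y := ⟨(h.exists_sup x.2.2 y.2.2).choose,
    x.2.1.trans (h.exists_sup x.2.2 y.2.2).choose_spec.2.1,
    (h.exists_sup x.2.2 y.2.2).choose_spec.1⟩
  inf_le_left x y := (h.exists_inf x.2.1 y.2.1).choose_spec.2.1
  inf_le_right x y := (h.exists_inf x.2.1 y.2.1).choose_spec.2.2.1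
  le_inf z x y h1 h2 := (h.exists_inf x.2.1 y.2.1).choose_spec.2.2.2.1 z.1 z.2.1 h1 h2
  le_sup_left x y := (h.exists_sup x.2.2 y.2.2).choose_spec.2.1
  le_sup_right x y := (h.exists_sup x.2.2 y.2.2).choose_spec.2.2.1
  sup_le x y z h1 h2 := (h.exists_sup x.2.2 y.2.2).choose_spec.2.2.2.1 z.1 z.2.2 h1 h2

theorem Interval.dist_inf (x y : h.Interval p q) :
    G.dist x.1 y.1 = G.dist x.1 (x ⊓ y).1 + G.dist (x ⊓ y).1 y.1 :=
  (h.exists_inf x.2.1 y.2.1).choose_spec.2.2.2.2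

theorem Interval.dist_sup (x y : h.Interval p q) :
    G.dist x.1 y.1 = G.dist x.1 (x ⊔ y).1 + G.dist (x ⊔ y).1 y.1 :=
  (h.exists_sup x.2.2 y.2.2).choose_spec.2.2.2.2

/-- The height of an element of an order interval. -/
noncomputable def Interval.height (x : h.Interval p q) : ℕ := G.dist p x.1

theorem Interval.height_add_dist {x y : h.Interval p q} (hxy : x ≤ y) :
    x.height + G.dist x.1 y.1 = y.height :=
  h.dist_add_of_dirLE x.2.1 hxy

/-- Both the meet and the join lie on geodesics from `x` to `y`; this computes the distance in two
ways. -/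
theorem Interval.height_inf_add_height_sup (x y : h.Interval p q) :
    (x ⊓ y).height + (x ⊔ y).height = x.height + y.height := by
  have h1 := Interval.dist_inf x y
  have h2 := Interval.dist_sup x y
  have e1 := Interval.height_add_dist (inf_le_left : x ⊓ y ≤ x)
  have e2 := Interval.height_add_dist (inf_le_right : x ⊓ y ≤ y)
  have e3 := Interval.height_add_dist (le_sup_left : x ≤ x ⊔ y)
  have e4 := Interval.height_add_dist (le_sup_right : y ≤ x ⊔ y)
  rw [G.dist_comm (u := x.1) (v := (x ⊓ y).1)] at h1
  rw [G.dist_comm (u := (x ⊔ y).1)] at h2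
  omega

theorem Interval.eq_of_le_of_height_le {x y : h.Interval p q} (hxy : x ≤ y)
    (hh : y.height ≤ x.height) : x = y := by
  have := Interval.height_add_dist hxy
  exact Subtype.ext (h.connected.eq_of_dist_eq_zero (by omega))

/-- The two sides of the modular law are comparable and, by the valuation identity, have equal
height. -/
instance : IsModularLattice (h.Interval p q) where
  sup_inf_le_assoc_of_le {x} y {z} hxz := by
    have hle : x ⊔ y ⊓ z ≤ (x ⊔ y) ⊓ z :=
      le_inf (sup_le_sup_left inf_le_left _) (sup_le hxz inf_le_right)
    refine (Interval.eq_of_le_of_height_le hle ?_).ge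
    have e1 := Interval.height_inf_add_height_sup (x ⊔ y) z
    have e2 := Interval.height_inf_add_height_sup x y
    have e3 := Interval.height_inf_add_height_sup x (y ⊓ z)
    have e4 := Interval.height_inf_add_height_sup y z
    have f1 : x ⊔ y ⊔ z = y ⊔ z := by
      rw [sup_assoc]
      exact sup_eq_right.mpr (hxz.trans le_sup_right)
    have f2 : x ⊓ (y ⊓ z) = x ⊓ y := by
      rw [inf_comm y z, ← inf_assoc, inf_eq_left.mpr hxz]
    rw [f1] at e1
    rw [f2] at e3
    omega

theorem Interval.covBy_iff {x y : h.Interval p q} : x ⋖ y ↔ arc x.1 y.1 := by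
  constructor
  · intro hxy
    rcases Relation.ReflTransGen.cases_head hxy.le with h1 | ⟨z, hz1, hz2⟩
    · exact absurd (Subtype.ext h1) hxy.ne
    · let z' : h.Interval p q := ⟨z, x.2.1.trans (.of_arc hz1), DirLE.trans hz2 y.2.2⟩
      have hxz : x ≤ z' := DirLE.of_arc hz1
      have hzy : z' ≤ y := hz2
      rcases hxy.eq_or_eq hxz hzy with h1 | h1
      · exact absurd (congrArg Subtype.val h1).symm (h.adj hz1).ne
      · rw [← h1]
        exact hz1
  · intro hxy
    refine ⟨lt_of_le_of_ne (DirLE.of_arc hxy)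
      fun e => (h.adj hxy).ne (congrArg Subtype.val e), fun z hz1 hz2 => ?_⟩
    have e1 := Interval.height_add_dist hz1.le
    have e2 := Interval.height_add_dist hz2.le
    have e3 := Interval.height_add_dist (hz1.trans hz2).le
    rw [h.dist_of_arc hxy] at e3
    have n1 : G.dist x.1 z.1 ≠ 0 := fun e =>
      hz1.ne (Subtype.ext (h.connected.eq_of_dist_eq_zero e))
    have n2 : G.dist z.1 y.1 ≠ 0 := fun e =>
      hz2.ne (Subtype.ext (h.connected.eq_of_dist_eq_zero e))
    omega

/-- The order interval between `p` and `q` is a complemented lattice. -/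
def Complemented (arc : V → V → Prop) (p q : V) : Prop :=
  DirLE arc p q ∧ ∀ x, Between arc p q x → ∃ y, Between arc p q y ∧
    (∀ z, DirLE arc p z → DirLE arc z x → DirLE arc z y → z = p) ∧
    (∀ z, DirLE arc z q → DirLE arc x z → DirLE arc y z → z = q)

theorem complemented_flip : Complemented (_root_.flip arc) p q ↔ Complemented arc q p := by
  simp only [Complemented, dirLE_flip, between_flip]
  refine and_congr_right fun _ => forall₂_congr fun x _ => exists_congr fun y => ?_
  rw [and_comm (a := ∀ z, DirLE arc z p → _)]

/-- `Complemented` refers to no ambient lattice, so results can be transferred between different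
order intervals and to the reversed orientation. -/
theorem Interval.isComplementedInterval_iff {a b : h.Interval p q} :
    IsComplementedInterval a b ↔ Complemented arc a.1 b.1 := by
  refine and_congr_right fun hab => ⟨fun H x hx => ?_, fun H x hax hxb => ?_⟩
  · obtain ⟨y, hy1, hy2⟩ := H ⟨x, a.2.1.trans hx.1, hx.2.trans b.2.2⟩ hx.1 hx.2
    have hay : a ≤ y := hy1 ▸ inf_le_right
    have hyb : y ≤ b := hy2 ▸ le_sup_right
    refine ⟨y.1, ⟨hay, hyb⟩, fun z h1 h2 h3 => ?_, fun z h1 h2 h3 => ?_⟩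
    · refine h.dirLE_antisymm ?_ h1
      let z' : h.Interval p q := ⟨z, a.2.1.trans h1, h3.trans y.2.2⟩
      exact (le_inf (show z' ≤ _ from h2) (show z' ≤ y from h3)).trans_eq hy1
    · refine h.dirLE_antisymm h1 ?_
      let z' : h.Interval p q := ⟨z, y.2.1.trans h3, h1.trans b.2.2⟩
      exact hy2.symm.trans_le (sup_le (show _ ≤ z' from h2) h3)
  · obtain ⟨y, hy, h1, h2⟩ := H x.1 ⟨hax, hxb⟩
    let y' : h.Interval p q := ⟨y, a.2.1.trans hy.1, hy.2.trans b.2.2⟩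
    have hay : a ≤ y' := hy.1
    have hyb : y' ≤ b := hy.2
    exact ⟨y', Subtype.ext (h1 _ (le_inf hax hay) (inf_le_left : x ⊓ y' ≤ x)
      (inf_le_right : x ⊓ y' ≤ y')), Subtype.ext (h2 _ (sup_le hxb hyb)
      (le_sup_left : x ≤ x ⊔ y') (le_sup_right : y' ≤ x ⊔ y'))⟩

theorem complemented_self (h : IsOrientedModular G arc) (p : V) : Complemented arc p p :=
  ⟨.refl _, fun x hx => ⟨x, hx, fun _ h1 h2 _ => h.dirLE_antisymm (h2.trans hx.2) h1,
    fun _ h1 h2 _ => h.dirLE_antisymm h1 (hx.1.trans h2)⟩⟩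

theorem Complemented.mono (h : IsOrientedModular G arc) {x y : V} (hpq : Complemented arc p q)
    (hx : DirLE arc p x) (hxy : DirLE arc x y) (hy : DirLE arc y q) : Complemented arc x y := by
  let b (z : V) (hz : Between arc p q z) : h.Interval p q := ⟨z, hz⟩
  have h1 : IsComplementedInterval (b p ⟨.refl _, hpq.1⟩) (b q ⟨hpq.1, .refl _⟩) :=
    Interval.isComplementedInterval_iff.mpr hpq
  exact Interval.isComplementedInterval_iff.mp
    (h1.mono (x := b x ⟨hx, hxy.trans hy⟩) (y := b y ⟨hx.trans hxy, hy⟩) hx hxy hy)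

theorem Complemented.of_atom (h : IsOrientedModular G arc) {b c : V} (hpq : Complemented arc p q)
    (hqb : arc q b) (hpc : arc p c) (hcb : DirLE arc c b) (hcq : ¬ DirLE arc c q) :
    Complemented arc p b := by
  have hpb := hpq.1.trans (.of_arc hqb)
  let b' (z : V) (hz : Between arc p b z) : h.Interval p b := ⟨z, hz⟩
  have h1 : IsComplementedInterval (b' p ⟨.refl _, hpb⟩) (b' q ⟨hpq.1, .of_arc hqb⟩) :=
    Interval.isComplementedInterval_iff.mpr hpq
  exact Interval.isComplementedInterval_iff.mp
    (h1.of_atom (b := b' b ⟨hpb, .refl _⟩) (c := b' c ⟨.of_arc hpc, hcb⟩)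
      (Interval.covBy_iff.mpr hqb) (Interval.covBy_iff.mpr hpc) hcb hcq)

theorem Complemented.of_coatom (h : IsOrientedModular G arc) {b c : V}
    (hpq : Complemented arc p q) (hbp : arc b p) (hcq : arc c q) (hbc : DirLE arc b c)
    (hpc : ¬ DirLE arc p c) : Complemented arc b q :=
  complemented_flip.mp (Complemented.of_atom h.flip (complemented_flip.mpr hpq) hbp hcq
    (dirLE_flip.mpr hbc) (by rwa [dirLE_flip]))

theorem Complemented.of_atom_of_coatom (h : IsOrientedModular G arc) {a b g g' : V}
    (hap : arc a p) (hpq : DirLE arc p q) (hqb : arc q b) (hpb : Complemented arc p b)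
    (haq : Complemented arc a q) (hg : Complemented arc g' g) (hag : DirLE arc a g')
    (hgb : DirLE arc g b) (hpg : ¬ DirLE arc p g') (hgq : ¬ DirLE arc g q) :
    Complemented arc a b := by
  have hab := haq.1.trans (.of_arc hqb)
  let b' (z : V) (hz : Between arc a b z) : h.Interval a b := ⟨z, hz⟩
  exact Interval.isComplementedInterval_iff.mp
    (IsComplementedInterval.of_atom_of_coatom (a := b' a ⟨.refl _, hab⟩) (b := b' b ⟨hab, .refl _⟩)
      (p := b' p ⟨.of_arc hap, hpb.1⟩) (q := b' q ⟨haq.1, .of_arc hqb⟩)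
      (g := b' g ⟨hag.trans hg.1, hgb⟩) (g' := b' g' ⟨hag, hg.1.trans hgb⟩)
      (Interval.covBy_iff.mpr hap) hpq (Interval.covBy_iff.mpr hqb)
      (Interval.isComplementedInterval_iff.mpr hpb) (Interval.isComplementedInterval_iff.mpr haq)
      (Interval.isComplementedInterval_iff.mpr hg) hag hgb hpg hgq)

end IsOrientedModular

end SimpleGraph

/-! ### Boolean pairs as complemented intervals. -/

namespace SimpleGraph.IsOrientedModular

variable {V : Type*} {G : SimpleGraph V} {arc : V → V → Prop} {p q : V}

/-- Induction on the height: `x` is the join of a lower cover `w` and a complement of `w`, and the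
valuation identity gives that complement height 1. -/
theorem Interval.exists_atoms (h : IsOrientedModular G arc) (hpq : DirLE arc p q) :
    ∀ (n : ℕ) (x : h.Interval p q), x.height = n → Complemented arc p x.1 →
      ∃ a : Fin n → h.Interval p q, (∀ i, (a i).height = 1) ∧
        ∀ y, (∀ i, a i ≤ y) → x ≤ y := by
  intro n
  induction n with
  | zero =>
    intro x hx _
    have : p = x.1 := h.connected.eq_of_dist_eq_zero hx
    refine ⟨Fin.elim0, fun i => i.elim0, fun y _ => ?_⟩
    change DirLE arc x.1 y.1
    rw [← this]
    exact y.2.1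
  | succ n ih =>
    intro x hx hc
    have hne : p ≠ x.1 := by
      intro e
      have : G.dist p x.1 = n + 1 := hx
      rw [← e, dist_self] at this
      omega
    obtain ⟨w, hpw, hwx⟩ := (Relation.ReflTransGen.cases_tail x.2.1).resolve_left hne.symm
    have hpw : DirLE arc p w := hpw
    have hwx' := DirLE.of_arc hwx
    let w' : h.Interval p q := ⟨w, hpw, hwx'.trans x.2.2⟩
    let p' : h.Interval p q := ⟨p, .refl _, hpq⟩
    have hp' : p'.height = 0 := dist_self
    have hw : w'.height = n := by
      have := h.dist_of_dirLE_of_arc hpw hwx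
      have : G.dist p w + 1 = n + 1 := this ▸ hx
      change G.dist p w = n
      omega
    obtain ⟨a, ha1, ha2⟩ := ih w' hw (hc.mono h (.refl _) hpw hwx')
    have hc' : IsComplementedInterval p' x := Interval.isComplementedInterval_iff.mpr hc
    obtain ⟨c, hc1, hc2⟩ := hc'.2 w' hpw hwx'
    have := Interval.height_inf_add_height_sup w' c
    rw [hc1, hc2] at this
    refine ⟨Fin.cons c a, fun i => ?_, fun y hy => ?_⟩
    · refine Fin.cases ?_ (fun i => ?_) i
      · rw [Fin.cons_zero]
        omega
      · rw [Fin.cons_succ]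
        exact ha1 i
    · rw [← hc2]
      refine sup_le (ha2 y fun i => ?_) ?_
      · simpa using hy i.succ
      · simpa using hy 0

/-- The top is a join of as many atoms as its height, so these atoms are independent and their
partial joins form the cube. -/
theorem exists_cube_of_complemented (h : IsOrientedModular G arc) (hpq : Complemented arc p q) :
    ∃ (n : ℕ) (f : Finset (Fin n) → V), Function.Injective f ∧
      (∀ S T : Finset (Fin n), S ⋖ T → G.Adj (f S) (f T) ∧ arc (f S) (f T)) ∧
      f ∅ = p ∧ f Finset.univ = q := by
  classical
  let t : h.Interval p q := ⟨q, hpq.1, .refl _⟩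
  let b : h.Interval p q := ⟨p, .refl _, hpq.1⟩
  let _ : OrderBot (h.Interval p q) := { bot := b, bot_le := fun x => x.2.1 }
  have hbot : (⊥ : h.Interval p q).height = 0 := dist_self
  obtain ⟨a, ha1, ha2⟩ := Interval.exists_atoms h hpq.1 _ t rfl hpq
  have hle : ∀ S : Finset (Fin t.height), (S.sup a).height ≤ S.card := by
    intro S
    induction S using Finset.induction_on with
    | empty => rw [Finset.sup_empty, hbot]; exact Nat.zero_le _
    | insert i S hi ih =>
      have := Interval.height_inf_add_height_sup (a i) (S.sup a)
      rw [Finset.sup_insert, Finset.card_insert_of_notMem hi]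
      have := ha1 i
      omega
  have htop : Finset.univ.sup a = t :=
    le_antisymm (Finset.univ.sup a).2.2 (ha2 _ fun i => Finset.le_sup (Finset.mem_univ i))
  -- The bound `hle` for `S` and for its complement must be sharp, since the two joins together
  -- reach the top.
  have hcard : ∀ S : Finset (Fin t.height), (S.sup a).height = S.card := by
    intro S
    have h1 := hle S
    have h2 := hle Sᶜ
    have h3 := Interval.height_inf_add_height_sup (S.sup a) (Sᶜ.sup a)
    rw [← Finset.sup_union, Finset.union_compl, htop] at h3
    have h4 := Finset.card_add_card_compl S
    rw [Fintype.card_fin] at h4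
    omega
  refine ⟨t.height, fun S => (S.sup a).1, fun S T hST => ?_, fun S T hST => ?_, rfl,
    congrArg Subtype.val htop⟩
  · have hST' : S.sup a = T.sup a := Subtype.ext hST
    have key : ∀ S T : Finset (Fin t.height), S.sup a = T.sup a → T ⊆ S := by
      intro S T hST
      have h1 : (S ∪ T).sup a = S.sup a := by rw [Finset.sup_union, hST, sup_idem]
      have h2 := hcard (S ∪ T)
      rw [h1, hcard S] at h2
      rw [Finset.eq_of_subset_of_card_le (Finset.subset_union_left (s₁ := S) (s₂ := T)) h2.ge]
      exact Finset.subset_union_right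
    exact (key T S hST'.symm).antisymm (key S T hST')
  · have hle' : S.sup a ≤ T.sup a := Finset.sup_mono hST.le
    have h1 := Interval.height_add_dist hle'
    rw [hcard, hcard] at h1
    obtain ⟨i, hi, rfl⟩ := Finset.covBy_iff_exists_insert.mp hST
    rw [Finset.card_insert_of_notMem hi] at h1
    have hadj : G.Adj (S.sup a).1 ((insert i S).sup a).1 := dist_eq_one_iff_adj.mp (by omega)
    exact ⟨hadj, h.arc_of_dirLE_of_adj hle' hadj⟩

/-- The cube is climbed one direction at a time with `Complemented.of_atom`, the atom being `f {i}`.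
-/
theorem complemented_of_cube (h : IsOrientedModular G arc) {n : ℕ} (f : Finset (Fin n) → V)
    (hf : Function.Injective f) (hcov : ∀ S T : Finset (Fin n), S ⋖ T → arc (f S) (f T)) :
    Complemented arc (f ∅) (f Finset.univ) := by
  classical
  have hins : ∀ (S : Finset (Fin n)) (i : Fin n), i ∉ S → arc (f S) (f (insert i S)) :=
    fun S i hi => hcov _ _ (Finset.covBy_insert hi)
  have hmono : ∀ S T : Finset (Fin n), DirLE arc (f S) (f (S ∪ T)) := by
    intro S T
    induction T using Finset.induction_on with
    | empty => rw [Finset.union_empty]; exact .refl _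
    | insert i T hi ih =>
      rw [Finset.union_insert]
      by_cases hi' : i ∈ S ∪ T
      · rwa [Finset.insert_eq_of_mem hi']
      · exact ih.trans (.of_arc (hins _ _ hi'))
  have hmono' : ∀ S T : Finset (Fin n), S ⊆ T → DirLE arc (f S) (f T) := by
    intro S T hST
    rw [← Finset.union_eq_right.mpr hST]
    exact hmono S T
  -- By injectivity `f (insert i S)` and `f (insert j S)` are distinct covers of `f S`, so they meet
  -- in `f S`. An `f {i}` below both would be below `f S`, against induction.
  have hnot : ∀ (S : Finset (Fin n)) (i : Fin n), i ∉ S → ¬ DirLE arc (f {i}) (f S) := by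
    intro S
    induction S using Finset.induction_on with
    | empty =>
      intro i hi hle
      have h1 := hins ∅ i hi
      exact (h.adj h1).ne (h.dirLE_antisymm (.of_arc h1) hle)
    | insert j S hj ih =>
      intro i hi hle
      have hij : i ≠ j := fun e => hi (e ▸ Finset.mem_insert_self _ _)
      have hiS : i ∉ S := fun e => hi (Finset.mem_insert_of_mem e)
      let I (T : Finset (Fin n)) : h.Interval (f ∅) (f Finset.univ) :=
        ⟨f T, hmono' _ _ (Finset.empty_subset _), hmono' _ _ (Finset.subset_univ _)⟩
      have c1 : I S ⋖ I (insert i S) := Interval.covBy_iff.mpr (hins S i hiS)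
      have c2 : I S ⋖ I (insert j S) := Interval.covBy_iff.mpr (hins S j hj)
      have hne : I (insert i S) ≠ I (insert j S) := by
        intro e
        have := hf (congrArg Subtype.val e)
        exact hi (this ▸ Finset.mem_insert_self _ _)
      have hinf : I (insert i S) ⊓ I (insert j S) = I S := by
        rcases c1.eq_or_eq (le_inf c1.le c2.le) inf_le_left with e | e
        · exact e
        · exact absurd ((c2.eq_or_eq c1.le (inf_eq_left.mp e)).resolve_left c1.ne') hne
      refine ih i hiS (?_ : I {i} ≤ I S)
      rw [← hinf]
      exact le_inf (hmono' _ _ (Finset.singleton_subset_iff.mpr (Finset.mem_insert_self _ _))) hle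
  have key : ∀ S : Finset (Fin n), Complemented arc (f ∅) (f S) := by
    intro S
    induction S using Finset.induction_on with
    | empty => exact h.complemented_self _
    | insert i S hi ih =>
      exact ih.of_atom h (hins S i hi) (hins ∅ i (Finset.notMem_empty _))
        (hmono' _ _ (Finset.insert_subset_insert _ (Finset.empty_subset _))) (hnot S i hi)
  exact key _

end SimpleGraph.IsOrientedModular

theorem OrientedWeightedGraph.isBooleanPair_iff {V : Type*} {Γ : OrientedWeightedGraph V}
    (h : Γ.graph.IsOrientedModular Γ.arc) {p q : V} :
    Γ.IsBooleanPair p q ↔ SimpleGraph.IsOrientedModular.Complemented Γ.arc p q := by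
  constructor
  · rintro ⟨n, f, hf, hcov, rfl, rfl⟩
    exact h.complemented_of_cube f hf fun S T hST => (hcov S T hST).2
  · exact h.exists_cube_of_complemented

/-! ### Projections of complemented intervals. -/

namespace SimpleGraph.IsOrientedModular

variable {V : Type*} {G : SimpleGraph V} {arc : V → V → Prop} {p q p' q' : V}

theorem IsGate.dist_le (h : IsOrientedModular G arc) {x y g k : V}
    (hg : IsGate G arc p q x g) (hk : IsGate G arc p q y k) : G.dist g k ≤ G.dist x y := by
  have h1 := hg.2 k hk.1
  have h2 := hk.2 g hg.1
  have c1 := G.dist_comm (u := k) (v := g)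
  have c2 := G.dist_comm (u := x) (v := y)
  have t1 := h.tri x y k
  have t2 := h.tri y x g
  omega

/-- Projecting there, back and there again is the same as projecting once. -/
theorem IsGate.gate_gate (h : IsOrientedModular G arc) {c d c' : V} (hc : Between arc p q c)
    (hd : IsGate G arc p' q' c d) (hc' : IsGate G arc p q d c') : IsGate G arc p' q' c' d := by
  obtain ⟨d', hd'⟩ := h.exists_gate hd.1.le c'
  have h1 := hd.2 d' hd'.1
  have h2 := hc'.2 c hc
  have h3 := hd'.2 d hd.1
  have c1 := G.dist_comm (u := d) (v := c)
  have c2 := G.dist_comm (u := d) (v := c')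
  have c3 := G.dist_comm (u := c) (v := c')
  have c4 := G.dist_comm (u := d) (v := d')
  have t := h.tri c c' d'
  rwa [h.connected.eq_of_dist_eq_zero (x := d) (y := d') (by omega)]

/-- Between two pairs of mutual gates, the projections are inverse to each other. -/
theorem isGate_of_mutual (h : IsOrientedModular G arc) {c₀ c₁ d₀ d₁ x y : V}
    (h0 : IsGate G arc p' q' c₀ d₀) (h0' : IsGate G arc p q d₀ c₀)
    (h1 : IsGate G arc p' q' c₁ d₁) (h1' : IsGate G arc p q d₁ c₁)
    (hx : Between arc d₀ d₁ x) (hy : IsGate G arc p q x y) : IsGate G arc p' q' y x := by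
  have hxb : Between arc p' q' x := ⟨h0.1.1.trans hx.1, hx.2.trans h1.1.2⟩
  obtain ⟨x', hx'⟩ := h.exists_gate hxb.le y
  have y0 := h0'.mono h hx.1 hy
  have y1 := hy.mono h hx.2 h1'
  have x0 := h0.mono h y0 hx'
  have x1 := hx'.mono h y1 h1
  -- Projections do not increase distances and the chains through `x`, `y` and `x'` have the same
  -- total length, so `x`, `y`, `x'` have the same heights over `d₀`, `c₀`, `d₀`. The gate equations
  -- then put both `x` and `x'` at distance `d(c₀, d₀)` from `y`, which forces `x = x'`.
  have a1 := h.dist_add_of_dirLE hx.1 hx.2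
  have a2 := h.dist_add_of_dirLE y0 y1
  have a3 := h.dist_add_of_dirLE x0 x1
  have l1 := h0'.dist_le h hy
  have l2 := hy.dist_le h h1'
  have l3 := h0.dist_le h hx'
  have l4 := hx'.dist_le h h1
  have l5 := h0.dist_le h h1
  have e1 := hx'.2 x hxb
  have e2 := hx'.2 d₀ h0.1
  have e3 := h0'.2 y hy.1
  have e4 := hy.2 c₀ h0'.1
  have e5 := h0.2 x hxb
  have c1 := G.dist_comm (u := y) (v := x)
  have c2 := G.dist_comm (u := y) (v := d₀)
  have c3 := G.dist_comm (u := x') (v := d₀)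
  have c4 := G.dist_comm (u := x) (v := c₀)
  have c5 := G.dist_comm (u := y) (v := c₀)
  have c6 := G.dist_comm (u := d₀) (v := c₀)
  have c7 := G.dist_comm (u := x') (v := x)
  rwa [h.connected.eq_of_dist_eq_zero (x := x) (y := x') (by omega)]

/-- The two projections restrict to mutually inverse order isomorphisms, along which complements are
carried over. -/
theorem complemented_of_mutual (h : IsOrientedModular G arc) {c₀ c₁ d₀ d₁ : V}
    (h0 : IsGate G arc p' q' c₀ d₀) (h0' : IsGate G arc p q d₀ c₀)
    (h1 : IsGate G arc p' q' c₁ d₁) (h1' : IsGate G arc p q d₁ c₁)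
    (hc : Complemented arc c₀ c₁) : Complemented arc d₀ d₁ := by
  have hp := h0'.1.le
  have hp' := h0.1.le
  choose φ hφ using h.exists_gate hp'
  choose ψ hψ using h.exists_gate hp
  have hφψ : ∀ x, Between arc d₀ d₁ x → φ (ψ x) = x := fun x hx =>
    (hφ _).unique h (h.isGate_of_mutual h0 h0' h1 h1' hx (hψ x))
  have hψφ : ∀ x, Between arc c₀ c₁ x → ψ (φ x) = x := fun x hx =>
    (hψ _).unique h (h.isGate_of_mutual h0' h0 h1' h1 hx (hφ x))
  have hφm : ∀ {x y}, DirLE arc x y → DirLE arc (φ x) (φ y) :=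
    fun hxy => (hφ _).mono h hxy (hφ _)
  have hψm : ∀ {x y}, DirLE arc x y → DirLE arc (ψ x) (ψ y) :=
    fun hxy => (hψ _).mono h hxy (hψ _)
  have e0 : φ c₀ = d₀ := (hφ _).unique h h0
  have e1 : φ c₁ = d₁ := (hφ _).unique h h1
  have e0' : ψ d₀ = c₀ := (hψ _).unique h h0'
  have e1' : ψ d₁ = c₁ := (hψ _).unique h h1'
  have bφ : ∀ x, Between arc c₀ c₁ x → Between arc d₀ d₁ (φ x) := fun x hx =>
    ⟨e0 ▸ hφm hx.1, e1 ▸ hφm hx.2⟩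
  have bψ : ∀ x, Between arc d₀ d₁ x → Between arc c₀ c₁ (ψ x) := fun x hx =>
    ⟨e0' ▸ hψm hx.1, e1' ▸ hψm hx.2⟩
  refine ⟨h0.mono h hc.1 h1, fun x hx => ?_⟩
  obtain ⟨y, hy, hy1, hy2⟩ := hc.2 (ψ x) (bψ x hx)
  refine ⟨φ y, bφ y hy, fun z z1 z2 z3 => ?_, fun z z1 z2 z3 => ?_⟩
  · have hz : Between arc d₀ d₁ z := ⟨z1, z2.trans hx.2⟩
    have := hy1 (ψ z) (bψ z hz).1 (hψm z2) (hψφ y hy ▸ hψm z3)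
    rw [← hφψ z hz, this, e0]
  · have hz : Between arc d₀ d₁ z := ⟨hx.1.trans z2, z1⟩
    have := hy2 (ψ z) (bψ z hz).2 (hψm z2) (hψφ y hy ▸ hψm z3)
    rw [← hφψ z hz, this, e1]

/-- The projection of a complemented interval to an interval spans a complemented interval. -/
theorem Complemented.gate (h : IsOrientedModular G arc) {g₀ g₁ : V} (hpq : Complemented arc p q)
    (hg₀ : IsGate G arc p' q' p g₀) (hg₁ : IsGate G arc p' q' q g₁) :
    Complemented arc g₀ g₁ := by
  -- Projecting back gives a subinterval from `c₀` to `c₁`, complemented as part of `[p, q]`, whose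
  -- ends are in mutual gate position with `g₀` and `g₁`.
  obtain ⟨c₀, hc₀⟩ := h.exists_gate hpq.1 g₀
  obtain ⟨c₁, hc₁⟩ := h.exists_gate hpq.1 g₁
  exact h.complemented_of_mutual (hg₀.gate_gate h ⟨.refl _, hpq.1⟩ hc₀) hc₀
    (hg₁.gate_gate h ⟨hpq.1, .refl _⟩ hc₁) hc₁
    (hpq.mono h hc₀.1.1 (hc₀.mono h (hg₀.mono h hpq.1 hg₁) hc₁) hc₁.1.2)

/-- A vertex below `b` that is nearer to a lower cover `a` of `b` lies below `a`. -/
theorem dirLE_of_dist (h : IsOrientedModular G arc) {a b g : V} (hab : arc a b)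
    (hgb : DirLE arc g b) (hd : G.dist g a + 1 = G.dist g b) : DirLE arc g a :=
  (h.dirLE_of_dist_add hgb (by rw [h.dist_of_arc hab, hd])).1

end SimpleGraph.IsOrientedModular

/-! ### Moving the ends of complemented intervals. -/

namespace SimpleGraph.IsOrientedModular

variable {V : Type*} {G : SimpleGraph V} {arc : V → V → Prop} {p q p₀ q₀ : V}

/-- One of the ends of the complemented interval from `p` to `q` can be moved along an edge
towards the corresponding end of the interval from `p₀` to `q₀`. -/
def CanApproach (G : SimpleGraph V) (arc : V → V → Prop) (p q p₀ q₀ : V) : Prop :=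
  (∃ p', G.Adj p p' ∧ Complemented arc p' q ∧ G.dist p' p₀ + 1 = G.dist p p₀) ∨
    ∃ q', G.Adj q q' ∧ Complemented arc p q' ∧ G.dist q' q₀ + 1 = G.dist q q₀

theorem canApproach_flip :
    CanApproach G (_root_.flip arc) q p q₀ p₀ ↔ CanApproach G arc p q p₀ q₀ := by
  simp only [CanApproach, complemented_flip]
  exact or_comm

/-- The end `p` moves up towards the gate, inside `[p, q]`, and subintervals remain complemented. -/
theorem canApproach_of_gate_ne (h : IsOrientedModular G arc) {g : V} (hpq : Complemented arc p q)
    (hg : IsGate G arc p q p₀ g) (hne : g ≠ p) : CanApproach G arc p q p₀ q₀ := by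
  left
  obtain ⟨p', hpp', hp'g⟩ := (Relation.ReflTransGen.cases_head hg.1.1).resolve_left hne.symm
  have hp'g : DirLE arc p' g := hp'g
  have hp' : Between arc p q p' := ⟨.of_arc hpp', hp'g.trans hg.1.2⟩
  refine ⟨p', h.adj hpp', hpq.mono h hp'.1 hp'.2 (.refl _), ?_⟩
  have h1 := hg.2 p' hp'
  have h2 := hg.2 p ⟨.refl _, hpq.1⟩
  have h3 := h.dist_add_of_dirLE hp'.1 hp'g
  rw [h.dist_of_arc hpp'] at h3
  have c1 := G.dist_comm (u := p₀) (v := p')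
  have c2 := G.dist_comm (u := p₀) (v := p)
  have c3 := G.dist_comm (u := g) (v := p')
  have c4 := G.dist_comm (u := g) (v := p)
  omega

theorem canApproach_of_gate_ne' (h : IsOrientedModular G arc) {g : V} (hpq : Complemented arc p q)
    (hg : IsGate G arc p q q₀ g) (hne : g ≠ q) : CanApproach G arc p q p₀ q₀ :=
  canApproach_flip.mp (h.flip.canApproach_of_gate_ne (complemented_flip.mpr hpq)
    (isGate_flip.mpr hg) hne)

theorem canApproach_of_gates (h : IsOrientedModular G arc) (hpq : Complemented arc p q)
    (hpq₀ : DirLE arc p₀ q₀)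
    (h1 : IsGate G arc p q p₀ p) (h2 : IsGate G arc p q q₀ q) (h3 : IsGate G arc p₀ q₀ p p₀)
    (hne : p ≠ p₀) : CanApproach G arc p q p₀ q₀ := by
  obtain ⟨p', hpp', hp'⟩ := h.connected.exists_adj_dist_add_one hne
  -- The gate equations force `m` to be a neighbour of `q` with `qm` parallel to `pp'`. If these
  -- edges go up, `p'` is a new atom and `q` moves to `m`; if they go down, `m` is a new coatom and
  -- `p` moves to `p'`.
  obtain ⟨m, m1, m2, m3⟩ := h.modular.2 p' q q₀
  have dpp' := dist_eq_one_iff_adj.mpr hpp'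
  have hp'n : ¬ Between arc p q p' := by
    intro hb
    have := h1.2 p' hb
    have c1 := G.dist_comm (u := p₀) (v := p')
    have c2 := G.dist_comm (u := p₀) (v := p)
    omega
  have e1 := h2.2 p ⟨.refl _, hpq.1⟩
  have e2 := h3.2 q₀ ⟨hpq₀, .refl _⟩
  have e3 := h1.2 q ⟨hpq.1, .refl _⟩
  have c1 := G.dist_comm (u := p₀) (v := p)
  have c2 := G.dist_comm (u := q₀) (v := p)
  have c3 := G.dist_comm (u := q₀) (v := q)
  have c4 := G.dist_comm (u := q) (v := p)
  have c5 := G.dist_comm (u := q₀) (v := m)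
  have c6 := G.dist_comm (u := q) (v := m)
  have c7 := G.dist_comm (u := p') (v := m)
  have c8 := G.dist_comm (u := q₀) (v := p')
  have c9 := G.dist_comm (u := p₀) (v := q)
  have t1 := h.tri p p' q₀
  have t2 := h.tri p' p₀ q₀
  have t3 := h.tri p p' q
  have t4 := h.tri p' p q
  have t5 := h.tri q p' p₀
  have c10 := G.dist_comm (u := q) (v := p')
  have c11 := G.dist_comm (u := p) (v := p')
  have hqm : G.dist q m = 1 := by omega
  have adjqm := dist_eq_one_iff_adj.mp hqm
  have t6 := h.tri p m q₀
  have t7 := h.tri p q m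
  have par : arc p p' ↔ arc q m := h.arc_iff_of_parallel hpp' adjqm (by omega) (by omega)
    (by omega)
  rcases h.arc_or_arc hpp' with ha | ha
  · have ha' := par.mp ha
    have hpm := hpq.1.trans (.of_arc ha')
    refine Or.inr ⟨m, adjqm, hpq.of_atom h ha' ha
      (h.dirLE_of_dist_add (x := p') hpm (by omega)).2 fun hle => hp'n ⟨.of_arc ha, hle⟩, ?_⟩
    omega
  · have ha' : arc m q := (h.arc_or_arc adjqm).resolve_left fun e => h.not_arc_symm (par.mpr e) ha
    have hp'q := (DirLE.of_arc ha).trans hpq.1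
    refine Or.inl ⟨p', hpp', hpq.of_coatom h ha ha'
      (h.dirLE_of_dist_add (x := m) hp'q (by omega)).1 fun hle => ?_, hp'⟩
    have := h2.2 m ⟨hle, .of_arc ha'⟩
    omega

/-- If some end does not project to its counterpart in the other interval, that counterpart can move
inside its own interval. Otherwise `p = p₀` would give `q = q₀` by the gate equations, so
`canApproach_of_gates` applies. -/
theorem canApproach_or_canApproach (h : IsOrientedModular G arc) (hpq : Complemented arc p q)
    (hpq₀ : Complemented arc p₀ q₀) (hne : p = p₀ → q ≠ q₀) :
    CanApproach G arc p q p₀ q₀ ∨ CanApproach G arc p₀ q₀ p q := by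
  obtain ⟨g1, h1⟩ := h.exists_gate hpq.1 p₀
  obtain ⟨g2, h2⟩ := h.exists_gate hpq.1 q₀
  obtain ⟨g3, h3⟩ := h.exists_gate hpq₀.1 p
  obtain ⟨g4, h4⟩ := h.exists_gate hpq₀.1 q
  by_cases n1 : g1 = p; swap
  · exact Or.inl (h.canApproach_of_gate_ne hpq h1 n1)
  by_cases n2 : g2 = q; swap
  · exact Or.inl (h.canApproach_of_gate_ne' hpq h2 n2)
  by_cases n3 : g3 = p₀; swap
  · exact Or.inr (h.canApproach_of_gate_ne hpq₀ h3 n3)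
  by_cases n4 : g4 = q₀; swap
  · exact Or.inr (h.canApproach_of_gate_ne' hpq₀ h4 n4)
  subst n1 n2 n3 n4
  by_cases hp : g1 = g3
  · refine absurd ?_ (hne hp)
    have e1 := h2.2 g1 ⟨.refl _, hpq.1⟩
    have e2 := h4.2 g3 ⟨.refl _, hpq₀.1⟩
    rw [hp] at e1
    have c := G.dist_comm (u := g2) (v := g4)
    exact h.connected.eq_of_dist_eq_zero (by omega)
  · exact Or.inl (h.canApproach_of_gates hpq hpq₀.1 h1 h2 h3 hp)

/-- The quadrangle condition for two moves of the upper end. -/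
theorem exists_quadrangle_hi (h : IsOrientedModular G arc) {q₁ q₂ : V}
    (hq : Complemented arc p q) (hq₁ : Complemented arc p q₁) (hq₂ : Complemented arc p q₂)
    (a1 : G.Adj q q₁) (a2 : G.Adj q q₂) (hne : q₁ ≠ q₂)
    (d1 : G.dist q₀ q₁ + 1 = G.dist q₀ q) (d2 : G.dist q₀ q₂ + 1 = G.dist q₀ q) :
    ∃ w, Complemented arc p w ∧ G.Adj w q₁ ∧ G.Adj w q₂ ∧ G.dist q₀ w + 2 = G.dist q₀ q := by
  obtain ⟨w, w1, w2, hw⟩ := h.modular.quadrangleCondition q₀ q q₁ q₂ a1 a2 hne d1 d2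
  refine ⟨w, ?_, w1, w2, hw⟩
  have hqw : q ≠ w := by
    rintro rfl
    omega
  have f1 : G.IsFourCycle q q₁ w q₂ := ⟨a1, w1.symm, w2, a2.symm, hqw, hne⟩
  have f2 : G.IsFourCycle q q₂ w q₁ := ⟨a2, w2.symm, w1, a1.symm, hqw, hne.symm⟩
  have f3 : G.IsFourCycle q₁ q q₂ w := ⟨a1.symm, a2, w2.symm, w1, hne, hqw⟩
  have f4 : G.IsFourCycle q₂ q q₁ w := ⟨a2.symm, a1, w1.symm, w2, hne.symm, hqw⟩
  have i1 := h.admissible.2 _ _ _ _ f1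
  have i2 := h.admissible.2 _ _ _ _ f2
  have i3 := h.admissible.2 _ _ _ _ f3
  have i4 := h.admissible.2 _ _ _ _ f4
  -- If both moves go up, `w` is the join of `q₁` and `q₂`. In opposite directions, `w` lies between
  -- them. If both go down, convexity puts `w` in `[p, q]`.
  rcases h.arc_or_arc a1 with o1 | o1 <;> rcases h.arc_or_arc a2 with o2 | o2
  · have k1 := i2.mp o2
    have hpw := hq₁.1.trans (.of_arc k1)
    let I (x : V) (hx : DirLE arc p x) (hxw : DirLE arc x w) : h.Interval p w := ⟨x, hx, hxw⟩
    have k2 := i1.mp o1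
    have s1 : IsComplementedInterval (I p (.refl _) hpw) (I q₁ hq₁.1 (.of_arc k1)) :=
      Interval.isComplementedInterval_iff.mpr hq₁
    have s2 : IsComplementedInterval (I p (.refl _) hpw) (I q₂ hq₂.1 (.of_arc k2)) :=
      Interval.isComplementedInterval_iff.mpr hq₂
    have s3 := Interval.isComplementedInterval_iff.mp (s1.sup s2)
    have c1 : I q₁ hq₁.1 (.of_arc k1) ⋖ I w hpw (.refl _) := Interval.covBy_iff.mpr k1
    have c2 : I q₂ hq₂.1 (.of_arc k2) ⋖ I w hpw (.refl _) := Interval.covBy_iff.mpr k2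
    rcases c1.eq_or_eq le_sup_left (sup_le c1.le c2.le) with e | e
    · exact absurd (congrArg Subtype.val ((c2.eq_or_eq (sup_eq_left.mp e) c1.le).resolve_right
        c1.ne)) hne
    · rwa [e] at s3
  · exact hq₁.mono h (.refl _) (hq₂.1.trans (.of_arc (i1.mp o1))) (.of_arc (i4.mp o2))
  · exact hq₂.mono h (.refl _) (hq₁.1.trans (.of_arc (i2.mp o2))) (.of_arc (i3.mp o1))
  · have t := h.tri q₁ q q₂
    rw [h.dist_of_arc o1, dist_eq_one_iff_adj.mpr a2] at t
    have n0 : G.dist q₁ q₂ ≠ 0 := fun e => hne (h.connected.eq_of_dist_eq_zero e)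
    have n1 : G.dist q₁ q₂ ≠ 1 := fun e => by
      rcases h.modular.dist_cases (dist_eq_one_iff_adj.mp e) q₀ with e | e <;> omega
    have hw := h.between_of_common_neighbor (p := p) (q := q) ⟨hq₁.1, .of_arc o1⟩
      ⟨hq₂.1, .of_arc o2⟩ (by omega) w1 w2
    exact hq.mono h (.refl _) hw.1 hw.2

theorem exists_quadrangle_lo (h : IsOrientedModular G arc) {p₁ p₂ : V}
    (hp : Complemented arc p q) (hp₁ : Complemented arc p₁ q) (hp₂ : Complemented arc p₂ q)
    (a1 : G.Adj p p₁) (a2 : G.Adj p p₂) (hne : p₁ ≠ p₂)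
    (d1 : G.dist p₀ p₁ + 1 = G.dist p₀ p) (d2 : G.dist p₀ p₂ + 1 = G.dist p₀ p) :
    ∃ w, Complemented arc w q ∧ G.Adj w p₁ ∧ G.Adj w p₂ ∧ G.dist p₀ w + 2 = G.dist p₀ p := by
  simpa only [complemented_flip] using h.flip.exists_quadrangle_hi (complemented_flip.mpr hp)
    (complemented_flip.mpr hp₁) (complemented_flip.mpr hp₂) a1 a2 hne d1 d2

/-- The lower end of an interval and the upper end of another can be moved simultaneously. -/
theorem complemented_of_moves (h : IsOrientedModular G arc) {p₁ q₁ : V}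
    (hpq : Complemented arc p q) (hp : Complemented arc p₁ q) (hq : Complemented arc p q₁)
    (hpq₀ : Complemented arc p₀ q₀) (a1 : G.Adj p p₁) (a2 : G.Adj q q₁)
    (d1 : G.dist p₀ p₁ + 1 = G.dist p₀ p) (d2 : G.dist q₀ q₁ + 1 = G.dist q₀ q) :
    Complemented arc p₁ q₁ := by
  rcases h.arc_or_arc a1 with o1 | o1 <;> rcases h.arc_or_arc a2 with o2 | o2
  · exact hq.mono h (.of_arc o1) (hp.1.trans (.of_arc o2)) (.refl _)
  -- The interval shrinks at both ends, and only `p₁ ≤ q₁` is in question: it follows from `p₁ ≤ g'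
  -- ≤ g ≤ q₁`, with the middle step by monotonicity of gates.
  · obtain ⟨g, hg⟩ := h.exists_gate hpq.1 q₀
    obtain ⟨g', hg'⟩ := h.exists_gate hpq.1 p₀
    have e1 := hg.2 q ⟨hpq.1, .refl _⟩
    have e2 := hg.2 q₁ ⟨hq.1, .of_arc o2⟩
    have e3 := hg'.2 p ⟨.refl _, hpq.1⟩
    have e4 := hg'.2 p₁ ⟨.of_arc o1, hp.1⟩
    have k1 := h.dirLE_of_dist o2 hg.1.2 (by omega)
    have k2 := dirLE_flip.mp (h.flip.dirLE_of_dist (a := p₁) (b := p) (g := g') o1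
      (dirLE_flip.mpr hg'.1.1) (by omega))
    exact hpq.mono h (.of_arc o1) (k2.trans ((hg'.mono h hpq₀.1 hg).trans k1)) (.of_arc o2)
  -- The interval grows at both ends. The projection of `[p₀, q₀]` to `[p₁, q₁]` is the auxiliary
  -- complemented interval; since the moves approach `p₀` and `q₀`, it satisfies `p ≰ g'` and `g ≰
  -- q`.
  · have hle := (DirLE.of_arc o1).trans hq.1
    obtain ⟨g, hg⟩ := h.exists_gate hle q₀
    obtain ⟨g', hg'⟩ := h.exists_gate hle p₀
    have e1 := hg.2 q ⟨hp.1, .of_arc o2⟩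
    have e2 := hg.2 q₁ ⟨hle, .refl _⟩
    have e3 := hg'.2 p ⟨.of_arc o1, hq.1⟩
    have e4 := hg'.2 p₁ ⟨.refl _, hle⟩
    refine Complemented.of_atom_of_coatom h o1 hpq.1 o2 hq hp (hpq₀.gate h hg' hg) hg'.1.1 hg.1.2
      (fun hle => ?_) (fun hle => ?_)
    · have := h.flip.dist_of_dirLE_of_arc (p := g') (q := p) (r := p₁) (dirLE_flip.mpr hle) o1
      omega
    · have := h.dist_of_dirLE_of_arc hle o2
      omega
  · exact hp.mono h (.refl _) ((DirLE.of_arc o1).trans hq.1) (.of_arc o2)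

end SimpleGraph.IsOrientedModular

/-! ### The 2-subdivision. -/

namespace OrientedWeightedGraph

open SimpleGraph SimpleGraph.IsOrientedModular

variable {V : Type*} {Γ : OrientedWeightedGraph V}

theorem IsModularComplex.isOrientedModular (hΓ : Γ.IsModularComplex) :
    Γ.graph.IsOrientedModular Γ.arc := ⟨hΓ.modular, hΓ.admissible⟩

theorem BooleanPair.complemented (h : Γ.graph.IsOrientedModular Γ.arc) (x : Γ.BooleanPair) :
    Complemented Γ.arc x.lo x.hi := (isBooleanPair_iff h).mp x.isBooleanPair

theorem exists_adj_of_canApproach (h : Γ.graph.IsOrientedModular Γ.arc) {x y : Γ.BooleanPair}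
    (hxy : CanApproach Γ.graph Γ.arc x.lo x.hi y.lo y.hi) :
    ∃ z, Γ.subdivisionGraph.Adj x z ∧ Γ.graph.dist z.lo y.lo + Γ.graph.dist z.hi y.hi + 1 =
      Γ.graph.dist x.lo y.lo + Γ.graph.dist x.hi y.hi := by
  rcases hxy with ⟨p, h1, h2, h3⟩ | ⟨q, h1, h2, h3⟩
  · refine ⟨⟨p, x.hi, (isBooleanPair_iff h).mpr h2⟩, Or.inr ⟨rfl, h1⟩, ?_⟩
    dsimp only
    omega
  · refine ⟨⟨x.lo, q, (isBooleanPair_iff h).mpr h2⟩, Or.inl ⟨rfl, h1⟩, ?_⟩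
    dsimp only
    omega

/-- Each approaching move lowers the sum by one. It may start from either end of the walk, so it
does not matter which of the two pairs can move. -/
theorem exists_walk_subdivisionGraph (h : Γ.graph.IsOrientedModular Γ.arc) (x y : Γ.BooleanPair) :
    ∃ w : Γ.subdivisionGraph.Walk x y,
      w.length = Γ.graph.dist x.lo y.lo + Γ.graph.dist x.hi y.hi := by
  induction hn : Γ.graph.dist x.lo y.lo + Γ.graph.dist x.hi y.hi generalizing x y with
  | zero =>
    obtain rfl : x = y := BooleanPair.ext (h.connected.eq_of_dist_eq_zero (by omega))
      (h.connected.eq_of_dist_eq_zero (by omega))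
    exact ⟨.nil, rfl⟩
  | succ n ih =>
    have hne : x.lo = y.lo → x.hi ≠ y.hi := by
      intro h1 h2
      rw [h1, h2, dist_self, dist_self] at hn
      omega
    rcases h.canApproach_or_canApproach (x.complemented h) (y.complemented h) hne with ha | ha
    · obtain ⟨z, hz, hd⟩ := exists_adj_of_canApproach h ha
      obtain ⟨w, hw⟩ := ih z y (by omega)
      exact ⟨.cons hz w, by rw [Walk.length_cons, hw]⟩
    · obtain ⟨z, hz, hd⟩ := exists_adj_of_canApproach h ha
      rw [Γ.graph.dist_comm (u := y.lo), Γ.graph.dist_comm (u := y.hi),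
        Γ.graph.dist_comm (u := z.lo), Γ.graph.dist_comm (u := z.hi)] at hd
      obtain ⟨w, hw⟩ := ih x z (by omega)
      exact ⟨w.concat hz.symm, by rw [Walk.length_concat, hw]⟩

theorem subdivisionGraph_connected (h : Γ.graph.IsOrientedModular Γ.arc) :
    Γ.subdivisionGraph.Connected := by
  obtain ⟨v⟩ := h.connected.nonempty
  exact { preconnected := fun x y => (exists_walk_subdivisionGraph h x y).choose.reachable
          nonempty := ⟨⟨v, v, (isBooleanPair_iff h).mpr (h.complemented_self v)⟩⟩ }

theorem dist_add_dist_le_length (h : Γ.graph.IsOrientedModular Γ.arc) {x y : Γ.BooleanPair}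
    (w : Γ.subdivisionGraph.Walk x y) :
    Γ.graph.dist x.lo y.lo + Γ.graph.dist x.hi y.hi ≤ w.length := by
  induction w with
  | nil => simp
  | @cons x z y hxz w ih =>
    have t1 := h.tri x.lo z.lo y.lo
    have t2 := h.tri x.hi z.hi y.hi
    rw [Walk.length_cons]
    rcases hxz with ⟨h1, h2⟩ | ⟨h1, h2⟩
    · rw [h1, dist_self] at t1
      rw [dist_eq_one_iff_adj.mpr h2] at t2
      rw [h1]
      omega
    · rw [h1, dist_self] at t2
      rw [dist_eq_one_iff_adj.mpr h2] at t1
      rw [h1]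
      omega

/-- The distance in the 2-subdivision. -/
theorem subdivisionGraph_dist (h : Γ.graph.IsOrientedModular Γ.arc) (x y : Γ.BooleanPair) :
    Γ.subdivisionGraph.dist x y = Γ.graph.dist x.lo y.lo + Γ.graph.dist x.hi y.hi := by
  obtain ⟨w, hw⟩ := exists_walk_subdivisionGraph h x y
  obtain ⟨w', hw'⟩ :=
    ((subdivisionGraph_connected h).preconnected x y).exists_walk_length_eq_dist
  have := dist_le w
  have := dist_add_dist_le_length h w'
  omega

theorem subdivisionGraph_edgesSeparate (h : Γ.graph.IsOrientedModular Γ.arc) :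
    Γ.subdivisionGraph.EdgesSeparate := by
  rintro x a b (⟨h1, h2⟩ | ⟨h1, h2⟩) <;>
    rw [subdivisionGraph_dist h, subdivisionGraph_dist h, h1]
  · have := h.modular.edgesSeparate x.hi _ _ h2
    omega
  · have := h.modular.edgesSeparate x.lo _ _ h2
    omega

theorem subdivisionGraph_quadrangleCondition (h : Γ.graph.IsOrientedModular Γ.arc) :
    Γ.subdivisionGraph.QuadrangleCondition := by
  have mixed : ∀ x a b c : Γ.BooleanPair, a.lo = b.lo → Γ.graph.Adj a.hi b.hi →
      a.hi = c.hi → Γ.graph.Adj a.lo c.lo →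
      Γ.subdivisionGraph.dist x b + 1 = Γ.subdivisionGraph.dist x a →
      Γ.subdivisionGraph.dist x c + 1 = Γ.subdivisionGraph.dist x a →
      ∃ w, Γ.subdivisionGraph.Adj w b ∧ Γ.subdivisionGraph.Adj w c ∧
        Γ.subdivisionGraph.dist x w + 2 = Γ.subdivisionGraph.dist x a := by
    intro x a b c l1 a1 l2 a2 hb hc
    simp only [subdivisionGraph_dist h] at hb hc ⊢
    rw [← l1] at hb
    rw [← l2] at hc
    have hpc := h.complemented_of_moves (a.complemented h) (l2 ▸ c.complemented h)
      (l1 ▸ b.complemented h) (x.complemented h) a2 a1 (by omega) (by omega)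
    refine ⟨⟨c.lo, b.hi, (isBooleanPair_iff h).mpr hpc⟩, Or.inr ⟨rfl, l1 ▸ a2.symm⟩,
      Or.inl ⟨rfl, l2 ▸ a1.symm⟩, ?_⟩
    dsimp only
    omega
  rintro x a b c (⟨l1, a1⟩ | ⟨l1, a1⟩) (⟨l2, a2⟩ | ⟨l2, a2⟩) hne hb hc
  · simp only [subdivisionGraph_dist h] at hb hc ⊢
    rw [← l1] at hb
    rw [← l2] at hc
    obtain ⟨w, hw, w1, w2, hd⟩ := h.exists_quadrangle_hi (a.complemented h)
      (l1 ▸ b.complemented h) (l2 ▸ c.complemented h) a1 a2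
      (fun e => hne (BooleanPair.ext (l1.symm.trans l2) e)) (q₀ := x.hi) (by omega) (by omega)
    refine ⟨⟨a.lo, w, (isBooleanPair_iff h).mpr hw⟩, Or.inl ⟨l1, w1⟩, Or.inl ⟨l2, w2⟩, ?_⟩
    dsimp only
    omega
  · exact mixed x a b c l1 a1 l2 a2 hb hc
  · obtain ⟨w, w1, w2, hw⟩ := mixed x a c b l2 a2 l1 a1 hc hb
    exact ⟨w, w2, w1, hw⟩
  · simp only [subdivisionGraph_dist h] at hb hc ⊢
    rw [← l1] at hb
    rw [← l2] at hc
    obtain ⟨w, hw, w1, w2, hd⟩ := h.exists_quadrangle_lo (a.complemented h)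
      (l1 ▸ b.complemented h) (l2 ▸ c.complemented h) a1 a2
      (fun e => hne (BooleanPair.ext e (l1.symm.trans l2))) (p₀ := x.lo) (by omega) (by omega)
    refine ⟨⟨w, a.hi, (isBooleanPair_iff h).mpr hw⟩, Or.inr ⟨l1, w1⟩, Or.inr ⟨l2, w2⟩, ?_⟩
    dsimp only
    omega

theorem subdivisionGraph_isModular (h : Γ.graph.IsOrientedModular Γ.arc) :
    Γ.subdivisionGraph.IsModular :=
  (subdivisionGraph_quadrangleCondition h).isModular (subdivisionGraph_connected h)
    (subdivisionGraph_edgesSeparate h)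

/-- The 4-cycles of the 2-subdivision: either one end is fixed and the other one runs through a
4-cycle, or both ends move along an edge. -/
theorem fourCycle_cases {a b c d : Γ.BooleanPair} (hc : Γ.subdivisionGraph.IsFourCycle a b c d) :
    (a.lo = b.lo ∧ c.lo = d.lo ∧ Γ.graph.IsFourCycle a.hi b.hi c.hi d.hi) ∨
    (a.hi = b.hi ∧ c.hi = d.hi ∧ Γ.graph.IsFourCycle a.lo b.lo c.lo d.lo) ∨
    (a.lo = b.lo ∧ c.lo = d.lo ∧ a.hi = d.hi ∧ b.hi = c.hi ∧ Γ.graph.Adj a.hi b.hi) ∨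
    (a.hi = b.hi ∧ c.hi = d.hi ∧ a.lo = d.lo ∧ b.lo = c.lo ∧ Γ.graph.Adj a.lo b.lo) := by
  obtain ⟨h1, h2, h3, h4, hac, hbd⟩ := hc
  have hac' : a.lo = c.lo → a.hi ≠ c.hi := fun e e' => hac (BooleanPair.ext e e')
  have hbd' : b.lo = d.lo → b.hi ≠ d.hi := fun e e' => hbd (BooleanPair.ext e e')
  have ne : ∀ {u v}, Γ.graph.Adj u v → u ≠ v := fun h => h.ne
  rcases h1 with ⟨e1, h1⟩ | ⟨e1, h1⟩ <;> rcases h2 with ⟨e2, h2⟩ | ⟨e2, h2⟩ <;>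
    rcases h3 with ⟨e3, h3⟩ | ⟨e3, h3⟩ <;> rcases h4 with ⟨e4, h4⟩ | ⟨e4, h4⟩ <;>
    have n1 := ne h1 <;> have n2 := ne h2 <;> have n3 := ne h3 <;> have n4 := ne h4 <;>
    simp only [IsFourCycle] <;> grind

theorem subdivision_isAdmissible (h : Γ.graph.IsOrientedModular Γ.arc) :
    Γ.subdivisionGraph.IsAdmissible Γ.subdivisionArc := by
  refine ⟨⟨?_, ?_⟩, ?_⟩
  · rintro p q (⟨h1, h2⟩ | ⟨h1, h2⟩)
    · exact Or.inl ⟨h1, h.adj h2⟩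
    · exact Or.inr ⟨h1, (h.adj h2).symm⟩
  · rintro p q (⟨h1, h2⟩ | ⟨h1, h2⟩)
    · have n : p.hi ≠ q.hi := h2.ne
      have := h.admissible.1.2 _ _ h2
      simpa [subdivisionArc, h1, n, n.symm] using this
    · have n : p.lo ≠ q.lo := h2.ne
      have := h.admissible.1.2 _ _ h2.symm
      simpa [subdivisionArc, h1, n, n.symm] using this
  · intro a b c d hc
    rcases fourCycle_cases hc with ⟨h1, h2, h3⟩ | ⟨h1, h2, h3⟩ | ⟨h1, h2, h3, h4, h5⟩ |
      ⟨h1, h2, h3, h4, h5⟩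
    · have n1 : a.hi ≠ b.hi := h3.1.ne
      have n2 : d.hi ≠ c.hi := h3.2.2.1.ne'
      simpa [subdivisionArc, h1, h2, n1, n2] using h.admissible.2 _ _ _ _ h3
    · have n1 : a.lo ≠ b.lo := h3.1.ne
      have n2 : d.lo ≠ c.lo := h3.2.2.1.ne'
      -- Moving the lower end up goes down in the 2-subdivision, hence the reversed orientation.
      simpa [subdivisionArc, h1, h2, n1, n2, _root_.flip] using h.flip.admissible.2 _ _ _ _ h3
    · have n1 : d.hi ≠ c.hi := h3 ▸ h4 ▸ h5.ne
      simp [subdivisionArc, h1, h2, h3, h4, n1]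
    · have n1 : d.lo ≠ c.lo := h3 ▸ h4 ▸ h5.ne
      simp [subdivisionArc, h1, h2, h3, h4, n1]

theorem subdivisionWeight_of_hi {x y : Γ.BooleanPair} (hxy : Γ.subdivisionGraph.Adj x y)
    (h : Γ.graph.Adj x.hi y.hi) :
    Γ.subdivisionWeight ⟨s(x, y), hxy⟩ = Γ.weight ⟨s(x.hi, y.hi), h⟩ / 2 :=
  dif_pos (show (s(x, y)).map BooleanPair.hi ∈ Γ.graph.edgeSet from h)

theorem subdivisionWeight_of_lo {x y : Γ.BooleanPair} (hxy : Γ.subdivisionGraph.Adj x y)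
    (hhi : x.hi = y.hi) (h : Γ.graph.Adj x.lo y.lo) :
    Γ.subdivisionWeight ⟨s(x, y), hxy⟩ = Γ.weight ⟨s(x.lo, y.lo), h⟩ / 2 :=
  dif_neg (show ¬ (s(x, y)).map BooleanPair.hi ∈ Γ.graph.edgeSet from
    fun h' => (show Γ.graph.Adj x.hi y.hi from h').ne hhi)

theorem subdivisionWeight_pos (hw : ∀ e, 0 < Γ.weight e) (e : Γ.subdivisionGraph.edgeSet) :
    0 < Γ.subdivisionWeight e := by
  unfold subdivisionWeight
  split <;> exact half_pos (hw _)

theorem weight_eq_of_fourCycle (hw : Γ.graph.IsOrbitInvariant Γ.weight) {a b c d : V}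
    (hc : Γ.graph.IsFourCycle a b c d) :
    Γ.weight ⟨s(a, b), hc.1⟩ = Γ.weight ⟨s(c, d), hc.2.2.1⟩ :=
  hw _ _ (.single ⟨a, b, c, d, hc, rfl, rfl⟩)

/-- Opposite edges of a 4-cycle of the 2-subdivision come either from opposite edges of a 4-cycle of
the original graph or from one and the same edge. -/
theorem subdivisionWeight_isOrbitInvariant (hw : Γ.graph.IsOrbitInvariant Γ.weight) :
    Γ.subdivisionGraph.IsOrbitInvariant Γ.subdivisionWeight := by
  intro e e' hee'
  induction hee' with
  | refl => rfl
  | tail _ hopp ih =>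
    refine ih.trans ?_
    obtain ⟨a, b, c, d, hc, he, he'⟩ := hopp
    rw [show _ = (⟨s(a, b), hc.1⟩ : Γ.subdivisionGraph.edgeSet) from Subtype.ext he,
      show _ = (⟨s(c, d), hc.2.2.1⟩ : Γ.subdivisionGraph.edgeSet) from Subtype.ext he']
    rcases fourCycle_cases hc with ⟨h1, h2, h3⟩ | ⟨h1, h2, h3⟩ | ⟨h1, h2, h3, h4, h5⟩ |
      ⟨h1, h2, h3, h4, h5⟩
    · rw [subdivisionWeight_of_hi _ h3.1, subdivisionWeight_of_hi _ h3.2.2.1,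
        weight_eq_of_fourCycle hw h3]
    · rw [subdivisionWeight_of_lo _ h1 h3.1, subdivisionWeight_of_lo _ h2 h3.2.2.1,
        weight_eq_of_fourCycle hw h3]
    · rw [subdivisionWeight_of_hi _ h5, subdivisionWeight_of_hi _ (h3 ▸ h4 ▸ h5.symm)]
      congr 3
      rw [h3, h4, Sym2.eq_swap]
    · rw [subdivisionWeight_of_lo _ h1 h5, subdivisionWeight_of_lo _ h2 (h3 ▸ h4 ▸ h5.symm)]
      congr 3
      rw [h3, h4, Sym2.eq_swap]

end OrientedWeightedGraph

theorem mainTheorem12 {V : Type*} (Γ : OrientedWeightedGraph V) (hΓ : Γ.IsModularComplex) :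
    Γ.twoSubdivision.IsModularComplex where
  finite := by
    have := hΓ.finite
    exact Finite.of_injective (fun x : Γ.BooleanPair => (x.lo, x.hi)) fun x y h =>
      OrientedWeightedGraph.BooleanPair.ext (congrArg Prod.fst h) (congrArg Prod.snd h)
  modular := Γ.subdivisionGraph_isModular hΓ.isOrientedModular
  admissible := Γ.subdivision_isAdmissible hΓ.isOrientedModular
  orbitInvariant := Γ.subdivisionWeight_isOrbitInvariant hΓ.orbitInvariant
  positive := Γ.subdivisionWeight_pos hΓ.positive
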